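/- **Setting.** Let $X$ be a set of examples, $f:X\to\{0,1\}$ a target, and $H\subset\{0,1\}^X$ a finite non-empty class of splitting functions that satisfies the Weak Learning Assumption for $f$ with advantage $\gamma>0$: for every (discrete) probability distribution $P$ on $X$ there is $h\in H$ with $\Pr_{x\sim P}(h(x)\ne f(x))\le\frac12-\gamma$. The data $S$ are a finite multiset of examples, labeled by $f$, split arbitrarily among $k\ge 1$ entities. A query for the number of points with some property is answered with noise $\mathrm{Lap}(s)$ as follows: each entity publishes its own count plus an independent $\mathrm{Lap}(s)$ variable (Laplace of scale $s$), and the coordinator adds these up. All noise is fresh and independent. **NoisyCounts** at a leaf $\ell$ with budget $\alpha'$. For every $h\in H$ the counts $\hat c_{y=a}$, $\hat c_{h=b}$, $\hat c_{y=a,h=b}$ ($a,b\in\{0,1\}$) of the data at $\ell$ are obtained with noise $\mathrm{Lap}(3|H|/\alpha')$, and with $\hat m=\hat c_{y=0}+\hat c_{y=1}$ one sets $$\hat J(\ell,h)=G\Bigl(\frac{\hat c_{y=1}}{\hat m}\Bigr)-\sum_{b\in\{0,1\}}\frac{\hat c_{h=b}}{\hat m}\,G\Bigl(\frac{\hat c_{y=1,h=b}}{\hat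 c_{y=0,h=b}+\hat c_{y=1,h=b}}\Bigr),$$ where $G$ is binary entropy to base $2$ (its argument is first projected to $[0,1]$). The output is some $\hat h\in H$ that maximizes $\hat J(\ell,\cdot)$, with the value $\hat J(\ell,\hat h)$. **Distributed DP-TopDown** with uniform budgeting $\mathcal B(d)=1/M$, on input $S$, $M\ge1$, $\varepsilon\in(0,1]$, $\alpha>0$. The tree starts as a single leaf, which is put in a priority queue with the split that NoisyCounts with budget $\frac{\alpha}{2M}$ returns, with priority $\hat J$. For $t=1,\dots,M$ (as long as the queue is not empty) an element $(\ell^*,h^*)$ of highest priority is popped, and $\ell^*$ is replaced by an internal node with splitting function $h^*$ and two leaves. For each new leaf $\ell$, with $\alpha_\ell=\frac{\alpha}{2M}$: the weight $|S_\ell|/|S|$ is estimated by $w$ = (the count $|S_\ell|$ with noise $\mathrm{Lap}(2/\alpha_\ell)$) divided by $|S|$; NoisyCounts with budget $\alpha_\ell/2$ returns $(\hat h,\hat J)$; and if $w\ge\varepsilon/M$, then $(\ell,\hat h)$ is put in the queue with priority $w\hat J$. Finally each leaf gets the majority label according to its two label counts, each obtained with noise $\mathrm{Lap}(4/\alpha)$.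 **Corollary.** There are universal constants $C_1,C_2>0$ and $p\in\mathbb N$ such that for all $X,H,f,\gamma,k,S$ as above, all $\alpha>0$, $\varepsilon,\delta\in(0,1]$, and every positive integer $M\ge(1/\varepsilon)^{C_1\log(1/\varepsilon)/\gamma^2}$: if $$|S|\ \ge\ C_2\,\frac{M^3k|H|}{\varepsilon^2\gamma^2\alpha}\,\Bigl(\log\Bigl(2+\frac{Mk|H|}{\varepsilon\gamma\delta}\Bigr)\Bigr)^{p},$$ then with probability at least $1-\delta$ the tree returned by this algorithm has training error at most $\varepsilon$ (the fraction of points $x$ of $S$ with $T(x)\neq f(x)$). In short: with uniform budgeting and NoisyCounts as $\mathrm{PrivateSplit}$, $(1/\varepsilon)^{O(\log(1/\varepsilon)/\gamma^2)}$ splits suffice for training error $\le\varepsilon$ with probability $\ge1-\delta$ once $|S|\ge\widetilde O\bigl(M^3k|H|/(\varepsilon^2\gamma^2\alpha)\bigr)$. -/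

import Mathlib

open MeasureTheory ProbabilityTheory

/-! Differentially private top-down decision tree learning over `k` data holders. Examples are
points of a type `X`, the target is `f : X → Bool`, and the class of splitting functions is a finite
set `H` of functions `X → Bool`. The data of holder `j` is the multiset `S j`. -/

namespace DPTree

/-! ### Laplace noise -/

/-- The Laplace distribution with scale `1`: density `exp (-|x|) / 2`. If `Z` has this law and
`b > 0`, then `b * Z` has the Laplace distribution `Lap(b)` of scale `b`. -/
noncomputable def stdLaplace : Measure ℝ :=
  volume.withDensity fun x => ENNReal.ofReal (Real.exp (-|x|) / 2)

instance stdLaplace_isProbabilityMeasure : IsProbabilityMeasure stdLaplace := by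
  have h2 : (∫ x : ℝ, Real.exp (-|x|) / 2) = 1 := by
    have h := integral_comp_abs (f := fun x => Real.exp (-x))
    rw [integral_exp_neg_Ioi_zero] at h
    rw [integral_div, h]
    norm_num
  have hi : Integrable (fun x : ℝ => Real.exp (-|x|) / 2) := by
    by_contra hc
    rw [integral_undef hc] at h2
    norm_num at h2
  constructor
  rw [stdLaplace, withDensity_apply _ MeasurableSet.univ, Measure.restrict_univ,
    ← ofReal_integral_eq_lintegral_ofReal hi (Filter.Eventually.of_forall fun x => by positivity),
    h2, ENNReal.ofReal_one]

/-- The counting queries that a data holder answers, with fresh noise, about one tree node: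
the number of points at the node (`weight`, used to estimate the weight of the node), the number of
points with label `a` (`label a`, used to label the final leaves), and, for each splitting
function `h`, the counts of points with label `a`, with `h`-value `b`, and with both. -/
inductive Query (X : Type*) where
  | weight : Query X
  | label (a : Bool) : Query X
  | countY (h : X → Bool) (a : Bool) : Query X
  | countH (h : X → Bool) (b : Bool) : Query X
  | countYH (h : X → Bool) (a b : Bool) : Query X

/-- One noise variable (of scale `1`) for every tree node (nodes are numbered in the order in which
they are created), every data holder and every query. -/
abbrev Noise (k : ℕ) (X : Type*) := ℕ × Fin k × Query X → ℝ

/-- All the noise variables are independent standard Laplace variables. -/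
noncomputable def noiseLaw (k : ℕ) (X : Type*) : Measure (Noise k X) :=
  Measure.infinitePi fun _ => stdLaplace

/-! ### Decision trees -/

/-- A binary decision tree; every leaf carries a number as its name. -/
inductive Tree (X : Type*) where
  | leaf (v : ℕ) : Tree X
  | node (h : X → Bool) (left right : Tree X) : Tree X

/-- The leaf reached by `x`: left where the splitting function is `0`, right where it is `1`. -/
def Tree.route {X : Type*} : Tree X → X → ℕ
  | .leaf v, _ => v
  | .node h l r, x => if h x then r.route x else l.route x

/-- `T.split v h v₀ v₁`: the leaf `v` is replaced by an internal node with splitting function `h`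
and two leaves `v₀` (for `h x = 0`) and `v₁` (for `h x = 1`). -/
def Tree.split {X : Type*} (v : ℕ) (h : X → Bool) (v₀ v₁ : ℕ) : Tree X → Tree X
  | .leaf u => if u = v then .node h (.leaf v₀) (.leaf v₁) else .leaf u
  | .node g l r => .node g (l.split v h v₀ v₁) (r.split v h v₀ v₁)

/-- A decision tree whose leaves are labeled by classes. -/
structure LabeledTree (X : Type*) where
  tree : Tree X
  label : ℕ → Bool

/-- The prediction at `x` is the label of the leaf that `x` is routed to. -/
def LabeledTree.predict {X : Type*} (T : LabeledTree X) (x : X) : Bool := T.label (T.tree.route x)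

/-! ### Data -/

/-- The data at leaf `v`, holder by holder. -/
def leafData {X : Type*} {k : ℕ} (S : Fin k → Multiset X) (T : Tree X) (v : ℕ) :
    Fin k → Multiset X :=
  fun j => (S j).filter fun x => T.route x = v

/-- The total number of data points. -/
def dataSize {X : Type*} {k : ℕ} (S : Fin k → Multiset X) : ℕ := ∑ j, (S j).card

/-- The fraction of all the data on which the tree errs. -/
noncomputable def trainingError {X : Type*} {k : ℕ} (f : X → Bool) (S : Fin k → Multiset X)
    (T : LabeledTree X) : ℝ :=
  (∑ j, ((S j).countP fun x => T.predict x ≠ f x : ℕ) : ℝ) / dataSize S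

/-- `H` satisfies the Weak Learning Assumption for the target `f` with advantage `γ`: for every
distribution `P` on `X`, some `h ∈ H` has `P (h x ≠ f x) ≤ 1 / 2 - γ`. -/
def WeakLearning {X : Type*} (H : Finset (X → Bool)) (f : X → Bool) (γ : ℝ) : Prop :=
  ∀ P : PMF X, ∃ h ∈ H, (P.toOuterMeasure {x | h x ≠ f x}).toReal ≤ 1 / 2 - γ

/-! ### The splitting criterion -/

/-- Binary entropy with logarithms to base `2`, so that its value at `1 / 2` is `1`. A noisy
proportion outside `[0, 1]` is first projected to `[0, 1]`. -/
noncomputable def entropy (q : ℝ) : ℝ := Real.binEntropy (max 0 (min 1 q)) / Real.log 2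

/-- The drop in entropy `J = G(q) - ∑ b, w b * G(q b)` computed from (exact or noisy) counts at a
node: `cY a` of points with label `a`, `cH b` of points sent to child `b`, and `cYH a b` of points
with both. Here `q = cY 1 / (cY 0 + cY 1)`, `w b = cH b / (cY 0 + cY 1)` and
`q b = cYH 1 b / (cYH 0 b + cYH 1 b)`. -/
noncomputable def entropyDrop (cY cH : Bool → ℝ) (cYH : Bool → Bool → ℝ) : ℝ :=
  entropy (cY true / (cY false + cY true)) -
    ∑ b, cH b / (cY false + cY true) * entropy (cYH true b / (cYH false b + cYH true b))

/-! ### The NoisyCounts implementation of the private split -/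

section NoisyCounts

variable {X : Type*} {k : ℕ}

/-- Every holder publishes the number of its points in `D` that satisfy `p`, with Laplace noise of
scale `s`, and the coordinator adds up the published counts. -/
noncomputable def noisyCount (ω : Noise k X) (v : ℕ) (D : Fin k → Multiset X) (c : Query X)
    (s : ℝ) (p : X → Bool) : ℝ :=
  ∑ j, (((D j).countP fun x => p x = true : ℕ) + s * ω (v, j, c) : ℝ)

/-- The estimate of the drop in entropy due to the splitting function `h`, at node `v` with
data `D` and privacy budget `α`. Each of the three types of counts is published, for each of the
`|H|` splitting functions, with budget `α / (3 * |H|)`, that is, with noise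
`Lap(3 * |H| / α)`. -/
noncomputable def noisyDrop (H : Finset (X → Bool)) (f : X → Bool) (ω : Noise k X) (v : ℕ)
    (D : Fin k → Multiset X) (α : ℝ) (h : X → Bool) : ℝ :=
  entropyDrop
    (fun a => noisyCount ω v D (.countY h a) (3 * H.card / α) fun x => f x == a)
    (fun b => noisyCount ω v D (.countH h b) (3 * H.card / α) fun x => h x == b)
    (fun a b => noisyCount ω v D (.countYH h a b) (3 * H.card / α) fun x => f x == a && h x == b)

/-- NoisyCounts: a splitting function in `H` of maximal estimated drop, and that estimate. -/
noncomputable def noisyCounts (H : Finset (X → Bool)) (hH : H.Nonempty) (f : X → Bool)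
    (ω : Noise k X) (v : ℕ) (D : Fin k → Multiset X) (α : ℝ) : (X → Bool) × ℝ :=
  let best := (H.exists_max_image (noisyDrop H f ω v D α) hH).choose
  (best, noisyDrop H f ω v D α best)

end NoisyCounts

/-! ### DP-TopDown -/

section TopDown

variable {X : Type*} {k : ℕ}

/-- An element of the priority queue: a leaf, its depth (the root has depth `1`), the splitting
function chosen for it, and its priority. -/
structure Item (X : Type*) where
  leaf : ℕ
  depth : ℕ
  split : X → Bool
  priority : ℝ

/-- The tree built so far, and the priority queue. -/
structure State (X : Type*) where
  tree : Tree X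
  queue : List (Item X)

/-- The processing of a new leaf `v` of depth `d`. Its budget is `α_v = α / 2 * B d`. Its weight
is estimated with budget `α_v / 2`, every holder publishing its count at `v` with noise
`Lap(2 / α_v)`; a split is chosen with budget `α_v / 2`; if the estimated weight is at least
`ε / M`, then the leaf is queued. -/
noncomputable def newItem (split : ℕ → (Fin k → Multiset X) → ℝ → (X → Bool) × ℝ) (B : ℕ → ℝ)
    (S : Fin k → Multiset X) (M : ℕ) (ε α : ℝ) (ω : Noise k X) (T : Tree X) (v d : ℕ) :
    List (Item X) :=
  let αv := α / 2 * B d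
  let w := noisyCount ω v (leafData S T v) .weight (2 / αv) (fun _ => true) / dataSize S
  let r := split v (leafData S T v) (αv / 2)
  if ε / M ≤ w then [⟨v, d, r.1, w * r.2⟩] else []

/-- The start: the tree is the single leaf `0`, which is queued with a split chosen with budget
`α / 2 * B 1`. -/
noncomputable def initState (split : ℕ → (Fin k → Multiset X) → ℝ → (X → Bool) × ℝ) (B : ℕ → ℝ)
    (S : Fin k → Multiset X) (α : ℝ) : State X :=
  let r := split 0 S (α / 2 * B 1)
  ⟨.leaf 0, [⟨0, 1, r.1, r.2⟩]⟩

/-- Iteration number `t` (counted from `0`): an element of highest priority is popped, its leaf is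
split into the new leaves `2 * t + 1` and `2 * t + 2`, and these are processed. With an empty queue
nothing is left to do. -/
noncomputable def step (split : ℕ → (Fin k → Multiset X) → ℝ → (X → Bool) × ℝ) (B : ℕ → ℝ)
    (S : Fin k → Multiset X) (M : ℕ) (ε α : ℝ) (ω : Noise k X) (t : ℕ) (s : State X) : State X :=
  match s.queue.argmax Item.priority with
  | none => s
  | some e =>
    let T := s.tree.split e.leaf e.split (2 * t + 1) (2 * t + 2)
    ⟨T, s.queue.filter (fun e' => e'.leaf ≠ e.leaf) ++
      newItem split B S M ε α ω T (2 * t + 1) (e.depth + 1) ++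
      newItem split B S M ε α ω T (2 * t + 2) (e.depth + 1)⟩

/-- The state after the first `t` iterations. -/
noncomputable def run (split : ℕ → (Fin k → Multiset X) → ℝ → (X → Bool) × ℝ) (B : ℕ → ℝ)
    (S : Fin k → Multiset X) (M : ℕ) (ε α : ℝ) (ω : Noise k X) : ℕ → State X
  | 0 => initState split B S α
  | t + 1 => step split B S M ε α ω t (run split B S M ε α ω t)

/-- The label of the leaf `v`: the majority label according to the two aggregated noisy label
counts, which are published with budget `α / 4` each, that is, with noise `Lap(4 / α)`. -/
noncomputable def leafLabel (f : X → Bool) (S : Fin k → Multiset X) (α : ℝ) (ω : Noise k X)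
    (T : Tree X) (v : ℕ) : Bool :=
  let c := fun a => noisyCount ω v (leafData S T v) (.label a) (4 / α) fun x => f x == a
  if c false < c true then true else false

/-- DP-TopDown with splitting procedure `split`, depth budgets `B`, at most `M` splits, target
error `ε` and privacy parameter `α`, on the distributed data `S`. -/
noncomputable def dpTopDown (split : ℕ → (Fin k → Multiset X) → ℝ → (X → Bool) × ℝ) (B : ℕ → ℝ)
    (f : X → Bool) (S : Fin k → Multiset X) (M : ℕ) (ε α : ℝ) (ω : Noise k X) : LabeledTree X :=
  let T := (run split B S M ε α ω M).tree
  ⟨T, leafLabel f S α ω T⟩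

/-- Uniform budgeting: every depth has the same share of the privacy budget. -/
noncomputable def uniformBudget (M : ℕ) : ℕ → ℝ := fun _ => 1 / M

end TopDown

end DPTree

/-! Take as potential the label entropy over the leaves, `Σ n_v G(q_v)`, where leaf `v` holds `n_v`
points. It bounds twice the error of majority labels, and a split lowers it by exactly `n_v` times
the drop `J` (`card_mul_exactDrop`, `potential_split`).

Gain. Weak learning is applied to the data at a leaf, reweighted so that both classes have equal
mass. It gives a split whose mean values on the two classes differ by `2γ`. Since `J` is a mutual
information, it can also be computed by conditioning on the label, and strong concavity of entropy
gives `J ≳ γ² q(1-q)` (`le_exactDrop`). With `l = log (1/ε)`, `q(1-q) ≳ G(q)/l` unless `G(q)` is far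
below `ε`. While the potential exceeds `9/5 ε|S|`, one of the at most `t+1` leaves is queued, has
non-tiny entropy and carries a share `1/(4(t+1))` of it (`SmallNoise.exists_queued`). So a step
multiplies the potential by at most `exp(-γ²/(48 l (t+1)))`. The harmonic sum turns this into
`M^(-γ²/(48 l))`, which is at most `ε` once `log M ≥ 48 l²/γ²`.

Noise. A union bound makes all noise variables at most `L = O(log)` at once, so that every count is
off by at most `η|S|`. Entropy is Hölder of order `1/2`, so drops at small leaves are badly
distorted, but the weight `n/|S|` compensates: all priorities are accurate to `101 √η`
(`goodItem_of_noiseBounded`). This costs at most half of the gain per step if `√η ≲ γ² ε/(l M)`. The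
lower bound on `M` gives `l²/γ² ≤ log M`, so a logarithm replaces a factor `l²/γ²`, and the sample
size needs `γ²` rather than `γ⁴` in its denominator. -/

namespace DPTree

/-! ### Binary entropy -/

theorem negMulLog_one_sub_le {x : ℝ} (hx : x ≤ 1) : Real.negMulLog (1 - x) ≤ x := by
  rcases eq_or_lt_of_le hx with rfl | h
  · simp
  · have h1 : 0 < 1 - x := by linarith
    have h2 := Real.one_sub_inv_le_log_of_pos h1
    have h3 : (1 - x) * (1 - (1 - x)⁻¹) ≤ (1 - x) * Real.log (1 - x) :=
      mul_le_mul_of_nonneg_left h2 h1.le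
    have h4 : (1 - x) * (1 - (1 - x)⁻¹) = -x := by field_simp; ring
    rw [Real.negMulLog]
    linarith

/-- The bound `log u ≥ 1 - 1/u` at `u = √x`, doubled. -/
theorem negMulLog_le_two_mul_sqrt {x : ℝ} (hx : 0 ≤ x) : Real.negMulLog x ≤ 2 * √x := by
  rcases eq_or_lt_of_le hx with rfl | h
  · simp
  · have hs : 0 < √x := Real.sqrt_pos.2 h
    have h2 := Real.one_sub_inv_le_log_of_pos hs
    have hx2 : x = √x * √x := (Real.mul_self_sqrt hx).symm
    have h3 : Real.log x = 2 * Real.log √x := by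
      conv_lhs => rw [hx2]
      rw [Real.log_mul hs.ne' hs.ne']; ring
    have h4 : x * (√x)⁻¹ = √x := by
      field_simp
      exact (Real.sq_sqrt hx).symm
    have h5 := mul_le_mul_of_nonneg_left h2 hx
    rw [Real.negMulLog, h3]
    nlinarith

theorem binEntropy_le_three_mul_sqrt {x : ℝ} (hx : 0 ≤ x) (hx1 : x ≤ 1) :
    Real.binEntropy x ≤ 3 * √x := by
  rw [Real.binEntropy_eq_negMulLog_add_negMulLog_one_sub]
  have h1 := negMulLog_le_two_mul_sqrt hx
  have h2 := negMulLog_one_sub_le hx1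
  have h3 : x ≤ √x := Real.le_sqrt_of_sq_le (by nlinarith)
  linarith

theorem mul_binEntropy_le {x t : ℝ} (hx : 0 ≤ x) (hx1 : x ≤ 1) (ht : 0 ≤ t) (ht1 : t ≤ 1) :
    t * Real.binEntropy x ≤ Real.binEntropy (t * x) := by
  have h := Real.strictConcave_binEntropy.concaveOn.2 (x := x) ⟨hx, hx1⟩ (y := 0) (by simp) ht
    (sub_nonneg.2 ht1) (by ring)
  simpa using h

/-- A concave function that vanishes at `0` is subadditive: scale down from `a + d` to each summand
and add. -/
theorem binEntropy_add_le {a d : ℝ} (ha : 0 ≤ a) (hd : 0 ≤ d) (had : a + d ≤ 1) :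
    Real.binEntropy (a + d) ≤ Real.binEntropy a + Real.binEntropy d := by
  rcases eq_or_lt_of_le (add_nonneg ha hd) with h | h
  · have h1 : a = 0 := by linarith
    have h2 : d = 0 := by linarith
    simp [h1, h2]
  · have h1 := mul_binEntropy_le h.le had (div_nonneg ha h.le)
      ((div_le_one h).2 (by linarith))
    have h2 := mul_binEntropy_le h.le had (div_nonneg hd h.le)
      ((div_le_one h).2 (by linarith))
    rw [div_mul_cancel₀ _ h.ne'] at h1 h2
    have h3 : a / (a + d) * Real.binEntropy (a + d) + d / (a + d) * Real.binEntropy (a + d)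
        = Real.binEntropy (a + d) := by field_simp
    linarith

theorem abs_binEntropy_sub_le {x y : ℝ} (hx : 0 ≤ x) (hx1 : x ≤ 1) (hy : 0 ≤ y) (hy1 : y ≤ 1) :
    |Real.binEntropy x - Real.binEntropy y| ≤ 3 * √|x - y| := by
  wlog h : x ≤ y generalizing x y
  · rw [abs_sub_comm, abs_sub_comm x y]
    exact this hy hy1 hx hx1 (le_of_not_ge h)
  · have h0 : |x - y| = y - x := by rw [abs_sub_comm, abs_of_nonneg (by linarith)]
    have h1 := binEntropy_add_le hx (d := y - x) (by linarith) (by linarith)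
    -- Entropy is not monotone; the opposite inequality is subadditivity after the reflection `x ↦ 1
    -- - x`.
    have h2 := binEntropy_add_le (a := 1 - y) (d := y - x) (by linarith) (by linarith) (by linarith)
    have h3 := binEntropy_le_three_mul_sqrt (x := y - x) (by linarith) (by linarith)
    rw [show 1 - y + (y - x) = 1 - x by ring, Real.binEntropy_one_sub, Real.binEntropy_one_sub] at h2
    rw [show x + (y - x) = y by ring] at h1
    rw [h0, abs_le]
    constructor <;> linarith

/-- The second derivative of the entropy is `-1/(x(1-x)) ≤ -4`, which leaves room for `2x²`. -/
theorem concaveOn_binEntropy_add_sq :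
    ConcaveOn ℝ (Set.Icc 0 1) fun x => Real.binEntropy x + 2 * x ^ 2 := by
  refine concaveOn_of_hasDerivWithinAt2_nonpos (convex_Icc 0 1)
    (f' := fun x => Real.log (1 - x) - Real.log x + 4 * x)
    (f'' := fun x => -(1 - x)⁻¹ - x⁻¹ + 4) ?_ ?_ ?_ ?_
  · have := Real.binEntropy_continuous
    fun_prop
  · intro x hx
    rw [interior_Icc] at hx
    have h := (Real.hasDerivAt_binEntropy hx.1.ne' hx.2.ne).add
      (((hasDerivAt_id x).pow 2).const_mul 2)
    refine (h.congr_deriv ?_).hasDerivWithinAt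
    simp; ring
  · intro x hx
    rw [interior_Icc] at hx
    have h1 : 1 - x ≠ 0 := by linarith [hx.2]
    have h := ((((hasDerivAt_id x).const_sub 1).log h1).sub (Real.hasDerivAt_log hx.1.ne')).add
      ((hasDerivAt_id x).const_mul 4)
    refine (h.congr_deriv ?_).hasDerivWithinAt
    simp [neg_div]
  · intro x hx
    rw [interior_Icc] at hx
    have h1 : 0 < 1 - x := by linarith [hx.2]
    have h0 := hx.1
    have : -(1 - x)⁻¹ - x⁻¹ + 4 = -(1 - 2 * x) ^ 2 / (x * (1 - x)) := by
      field_simp; ring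
    rw [this]
    exact div_nonpos_of_nonpos_of_nonneg (by nlinarith [sq_nonneg (1 - 2 * x)]) (by positivity)

/-- The quadratic term is the variance identity `a x² + b y² - (a x + b y)² = a b (x - y)²`. -/
theorem binEntropy_strong_concave {a b x y : ℝ} (ha : 0 ≤ a) (hb : 0 ≤ b) (hab : a + b = 1)
    (hx : x ∈ Set.Icc (0 : ℝ) 1) (hy : y ∈ Set.Icc (0 : ℝ) 1) :
    a * Real.binEntropy x + b * Real.binEntropy y + 2 * (a * b) * (x - y) ^ 2 ≤
      Real.binEntropy (a * x + b * y) := by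
  have h := concaveOn_binEntropy_add_sq.2 hx hy ha hb hab
  simp only [smul_eq_mul] at h
  have hb' : b = 1 - a := by linarith
  subst hb'
  nlinarith

theorem two_mul_log_two_le_binEntropy {q : ℝ} (h0 : 0 ≤ q) (h1 : q ≤ 1 / 2) :
    2 * q * Real.log 2 ≤ Real.binEntropy q := by
  have h := mul_binEntropy_le (x := 2⁻¹) (t := 2 * q) (by norm_num) (by norm_num) (by linarith)
    (by linarith)
  rwa [Real.binEntropy_two_inv, show 2 * q * 2⁻¹ = q by ring] at h

/-! ### Entropy to base two -/

theorem entropy_of_mem {q : ℝ} (h0 : 0 ≤ q) (h1 : q ≤ 1) :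
    entropy q = Real.binEntropy q / Real.log 2 := by
  rw [entropy, min_eq_right h1, max_eq_right h0]

theorem proj_mem (q : ℝ) : 0 ≤ max 0 (min 1 q) ∧ max 0 (min 1 q) ≤ 1 :=
  ⟨le_max_left _ _, max_le zero_le_one (min_le_left _ _)⟩

theorem entropy_nonneg (q : ℝ) : 0 ≤ entropy q :=
  div_nonneg (Real.binEntropy_nonneg (proj_mem q).1 (proj_mem q).2) (Real.log_nonneg one_le_two)

theorem entropy_le_one (q : ℝ) : entropy q ≤ 1 :=
  (div_le_one (Real.log_pos one_lt_two)).2 Real.binEntropy_le_log_two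

theorem abs_entropy_sub_le (x y : ℝ) : |entropy x - entropy y| ≤ 5 * √|x - y| := by
  have hx := proj_mem x
  have hy := proj_mem y
  have h1 := abs_binEntropy_sub_le hx.1 hx.2 hy.1 hy.2
  have h2 : |max 0 (min 1 x) - max 0 (min 1 y)| ≤ |x - y| := by
    refine (abs_max_sub_max_le_max _ _ _ _).trans (max_le (by simp) ?_)
    exact (abs_min_sub_min_le_max _ _ _ _).trans (max_le (by simp) le_rfl)
  have h3 : √|max 0 (min 1 x) - max 0 (min 1 y)| ≤ √|x - y| := Real.sqrt_le_sqrt h2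
  have h4 := Real.log_two_gt_d9
  have h5 := Real.sqrt_nonneg |x - y|
  rw [entropy, entropy, ← sub_div, abs_div, abs_of_pos (by linarith : 0 < Real.log 2),
    div_le_iff₀ (by linarith)]
  nlinarith

theorem two_mul_min_le_entropy {q : ℝ} (h0 : 0 ≤ q) (h1 : q ≤ 1) :
    2 * min q (1 - q) ≤ entropy q := by
  rw [entropy_of_mem h0 h1, le_div_iff₀ (Real.log_pos one_lt_two)]
  rcases le_total q (1 / 2) with h | h
  · rw [min_eq_left (by linarith)]
    exact two_mul_log_two_le_binEntropy h0 h
  · rw [min_eq_right (by linarith), ← Real.binEntropy_one_sub]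
    exact two_mul_log_two_le_binEntropy (by linarith) (by linarith)

/-- Up to a logarithmic factor, `q * (1 - q)` is as large as the entropy of `q`, provided that the
entropy is not tiny. -/
theorem binEntropy_le_mul_log {q l : ℝ} (h0 : 0 ≤ q) (h1 : q ≤ 1) (hl : 1 / 2 ≤ l)
    (hq : Real.exp (-l) / 20 ≤ Real.binEntropy q) :
    Real.binEntropy q ≤ 42 * l * (q * (1 - q)) := by
  wlog h : q ≤ 1 / 2 generalizing q
  · have := this (q := 1 - q) (by linarith) (by linarith) (by rwa [Real.binEntropy_one_sub])
      (by linarith)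
    rw [Real.binEntropy_one_sub] at this
    linarith
  have he := Real.exp_pos (-l)
  have h2 := binEntropy_le_three_mul_sqrt h0 h1
  have h3 : Real.exp (-l) / 60 ≤ √q := by linarith
  have h4 : (Real.exp (-l) / 60) ^ 2 ≤ q := by
    rw [← Real.sq_sqrt h0]
    exact pow_le_pow_left₀ (by positivity) h3 2
  have hq0 : 0 < q := lt_of_lt_of_le (by positivity) h4
  -- `G ≤ 3√q` and the lower bound on `G` keep `q` away from `0`; `8.4` exceeds `2 log 60`. Then `1
  -- - log q ≤ 2l + 9.4 ≤ 21 l` as `l ≥ 1/2`, and `q ≤ 2q(1-q)` doubles `21` to `42`.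
  have h5 : -(2 * l) - 8.4 ≤ Real.log q := by
    refine le_trans ?_ (Real.log_le_log (by positivity) h4)
    rw [Real.log_pow, Real.log_div he.ne' (by norm_num), Real.log_exp]
    have h6 : Real.log 60 ≤ Real.log (2 ^ 6) := Real.log_le_log (by norm_num) (by norm_num)
    rw [Real.log_pow] at h6
    have := Real.log_two_lt_d9
    push_cast at *
    linarith
  rw [Real.binEntropy_eq_negMulLog_add_negMulLog_one_sub, Real.negMulLog]
  have h7 := negMulLog_one_sub_le h1
  have h8 : q * (1 - Real.log q) ≤ q * (21 * l) :=
    mul_le_mul_of_nonneg_left (by linarith) h0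
  nlinarith [mul_nonneg (mul_nonneg h0 (by linarith : 0 ≤ l)) (by linarith : 0 ≤ 1 - 2 * q)]

/-! ### The drop in entropy computed from exact counts -/

/-- `entropyDrop` of the exact counts `c a b` of points with label `a` sent to child `b`. -/
noncomputable def exactDrop (c : Bool → Bool → ℝ) : ℝ :=
  entropyDrop (fun a => c a false + c a true) (fun b => c false b + c true b) c

/-- In terms of `n log n` the drop becomes symmetric in label and child, so the conditioning can be
exchanged. -/
theorem mul_binEntropy_div {a b : ℝ} (ha : 0 ≤ a) (hb : 0 ≤ b) :
    (a + b) * Real.binEntropy (b / (a + b)) =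
      (a + b) * Real.log (a + b) - a * Real.log a - b * Real.log b := by
  rcases eq_or_lt_of_le (add_nonneg ha hb) with h | h
  · have h1 : a = 0 := by linarith
    have h2 : b = 0 := by linarith
    simp [h1, h2]
  · rw [Real.binEntropy_eq_negMulLog_add_negMulLog_one_sub,
      show 1 - b / (a + b) = a / (a + b) by field_simp; ring]
    have key : ∀ x : ℝ, 0 ≤ x → (a + b) * Real.negMulLog (x / (a + b)) =
        x * Real.log (a + b) - x * Real.log x := by
      intro x hx
      rcases eq_or_lt_of_le hx with rfl | hx
      · simp
      · rw [Real.negMulLog, Real.log_div hx.ne' h.ne']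
        field_simp
        ring
    rw [mul_add, key a ha, key b hb]
    ring

theorem entropy_div {a b : ℝ} (ha : 0 ≤ a) (hb : 0 ≤ b) :
    entropy (b / (a + b)) = Real.binEntropy (b / (a + b)) / Real.log 2 :=
  entropy_of_mem (div_nonneg hb (add_nonneg ha hb)) (div_le_one_of_le₀ (by linarith) (by linarith))

theorem mul_entropy_div {a b : ℝ} (ha : 0 ≤ a) (hb : 0 ≤ b) :
    (a + b) * entropy (b / (a + b)) =
      ((a + b) * Real.log (a + b) - a * Real.log a - b * Real.log b) / Real.log 2 := by
  rw [entropy_div ha hb, ← mul_binEntropy_div ha hb, mul_div_assoc]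

theorem mul_exactDrop {c : Bool → Bool → ℝ} {n : ℝ}
    (hn : c false false + c false true + (c true false + c true true) = n) (hn0 : n ≠ 0) :
    n * exactDrop c = n * entropy ((c true false + c true true) / n) -
      ((c false false + c true false) * entropy (c true false / (c false false + c true false)) +
      (c false true + c true true) * entropy (c true true / (c false true + c true true))) := by
  simp only [exactDrop, entropyDrop, Fintype.sum_bool, hn]
  field_simp
  ring

/-- A splitting function whose values on the two classes differ in mean by at least `2 * γ` reduces
the entropy at a node by a multiple of `γ ^ 2 * q * (1 - q)`. -/
theorem le_exactDrop {c : Bool → Bool → ℝ} (hc : ∀ a b, 0 ≤ c a b) {γ n₀ n₁ : ℝ} (hγ : 0 ≤ γ)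
    (h₀ : c false false + c false true = n₀) (h₁ : c true false + c true true = n₁)
    (hn₀ : 0 < n₀) (hn₁ : 0 < n₁)
    (hw : n₁ * c false true + n₀ * c true false ≤ (1 / 2 - γ) * (2 * n₀ * n₁)) :
    8 * γ ^ 2 * (n₁ / (n₀ + n₁) * (1 - n₁ / (n₀ + n₁))) ≤ exactDrop c * Real.log 2 := by
  have hl := Real.log_pos one_lt_two
  have hn : 0 < n₀ + n₁ := by linarith
  have e := mul_exactDrop (c := c) (n := n₀ + n₁) (by rw [h₀, h₁]) hn.ne'
  rw [h₁, mul_entropy_div hn₀.le hn₁.le, mul_entropy_div (hc _ _) (hc _ _),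
    mul_entropy_div (hc _ _) (hc _ _)] at e
  -- Exchange of the conditioning: the same mutual information is the entropy of the `h`-value minus
  -- its mean entropy within the two classes. Weak learning controls the class means `p₀` and `p₁`
  -- directly.
  have ep := mul_binEntropy_div (a := c false false + c true false)
    (b := c false true + c true true) (add_nonneg (hc _ _) (hc _ _)) (add_nonneg (hc _ _) (hc _ _))
  have e0 := mul_binEntropy_div (hc false false) (hc false true)
  have e1 := mul_binEntropy_div (hc true false) (hc true true)
  rw [show c false false + c true false + (c false true + c true true) = n₀ + n₁ by
    rw [← h₀, ← h₁]; ring] at ep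
  rw [h₀] at e0
  rw [h₁] at e1
  set p₀ := c false true / n₀ with hp₀
  set p₁ := c true true / n₁ with hp₁
  have m₀ : p₀ ∈ Set.Icc (0 : ℝ) 1 :=
    ⟨div_nonneg (hc _ _) hn₀.le, (div_le_one hn₀).2 (by linarith [hc false false])⟩
  have m₁ : p₁ ∈ Set.Icc (0 : ℝ) 1 :=
    ⟨div_nonneg (hc _ _) hn₁.le, (div_le_one hn₁).2 (by linarith [hc true false])⟩
  have hs := binEntropy_strong_concave (a := n₀ / (n₀ + n₁)) (b := n₁ / (n₀ + n₁)) (by positivity)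
    (by positivity) (by field_simp) m₀ m₁
  rw [show n₀ / (n₀ + n₁) * p₀ + n₁ / (n₀ + n₁) * p₁ = (c false true + c true true) / (n₀ + n₁) by
    rw [hp₀, hp₁]; field_simp] at hs
  have hgap : 2 * γ ≤ p₁ - p₀ := by
    have : p₁ - p₀ = 1 - (n₁ * c false true + n₀ * c true false) / (n₀ * n₁) := by
      rw [hp₀, hp₁, show c true true = n₁ - c true false by linarith]
      field_simp
      ring
    rw [this]
    have : (n₁ * c false true + n₀ * c true false) / (n₀ * n₁) ≤ 1 - 2 * γ := by
      rw [div_le_iff₀ (by positivity)]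
      linarith
    linarith
  have hsq : (2 * γ) ^ 2 ≤ (p₀ - p₁) ^ 2 := by
    rw [← neg_sub p₁ p₀, neg_sq]
    exact pow_le_pow_left₀ (by linarith) hgap 2
  have hJ : exactDrop c * Real.log 2 =
      Real.binEntropy ((c false true + c true true) / (n₀ + n₁)) -
      (n₀ / (n₀ + n₁) * Real.binEntropy p₀ + n₁ / (n₀ + n₁) * Real.binEntropy p₁) := by
    have : (n₀ + n₁) * (exactDrop c * Real.log 2) =
        (n₀ + n₁) * Real.binEntropy ((c false true + c true true) / (n₀ + n₁)) -
        (n₀ * Real.binEntropy p₀ + n₁ * Real.binEntropy p₁) := by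
      rw [← mul_assoc, e, ep, e0, e1]
      field_simp
      ring
    field_simp
    linarith
  rw [hJ]
  have hq : n₁ / (n₀ + n₁) * (1 - n₁ / (n₀ + n₁)) = n₀ / (n₀ + n₁) * (n₁ / (n₀ + n₁)) := by
    field_simp
    ring
  rw [hq]
  have := mul_le_mul_of_nonneg_left hsq
    (show 0 ≤ 2 * (n₀ / (n₀ + n₁) * (n₁ / (n₀ + n₁))) by positivity)
  linarith

theorem abs_exactDrop_le_one {c : Bool → Bool → ℝ} (hc : ∀ a b, 0 ≤ c a b) {n : ℝ}
    (hn : c false false + c false true + (c true false + c true true) = n) (hn0 : 0 < n) :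
    |exactDrop c| ≤ 1 := by
  have e := mul_exactDrop hn hn0.ne'
  have g0 := entropy_nonneg ((c true false + c true true) / n)
  have g1 := entropy_le_one ((c true false + c true true) / n)
  have a0 := entropy_nonneg (c true false / (c false false + c true false))
  have a1 := entropy_le_one (c true false / (c false false + c true false))
  have b0 := entropy_nonneg (c true true / (c false true + c true true))
  have b1 := entropy_le_one (c true true / (c false true + c true true))
  have k0 : 0 ≤ c false false + c true false := add_nonneg (hc _ _) (hc _ _)
  have k1 : 0 ≤ c false true + c true true := add_nonneg (hc _ _) (hc _ _)
  have u1 := mul_le_mul_of_nonneg_left a1 k0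
  have u2 := mul_le_mul_of_nonneg_left b1 k1
  have u3 := mul_nonneg k0 a0
  have u4 := mul_nonneg k1 b0
  have u5 := mul_le_mul_of_nonneg_left g1 hn0.le
  have u6 := mul_nonneg hn0.le g0
  rw [abs_le]
  constructor
  · refine le_of_mul_le_mul_left ?_ hn0
    linarith
  · refine le_of_mul_le_mul_left ?_ hn0
    linarith

/-! ### The effect of noise on the drop in entropy -/

/-- The condition `4 * E ≤ b` keeps the noisy denominator above `b / 2`. -/
theorem abs_div_sub_div_le {a a' b b' E : ℝ} (hE : 0 ≤ E) (ha : 0 ≤ a) (hab : a ≤ b) (hb : 0 < b)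
    (hEb : 4 * E ≤ b) (ha' : |a' - a| ≤ E) (hb' : |b' - b| ≤ 2 * E) :
    |a' / b' - a / b| ≤ 6 * (E / b) := by
  have h2 : b / 2 ≤ b' := by linarith [(abs_le.1 hb').1]
  have h3 : 0 < b' := by linarith
  have e : a' / b' - a / b = ((a' - a) * b - a * (b' - b)) / (b' * b) := by
    field_simp
    ring
  have h4 : |(a' - a) * b - a * (b' - b)| ≤ 3 * E * b := by
    refine (abs_sub _ _).trans ?_
    rw [abs_mul, abs_mul, abs_of_pos hb, abs_of_nonneg ha]
    have h5 := mul_le_mul_of_nonneg_right ha' hb.le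
    have h6 := mul_le_mul hab hb' (abs_nonneg _) hb.le
    linarith
  rw [e, abs_div, abs_of_pos (mul_pos h3 hb), div_le_iff₀ (mul_pos h3 hb)]
  refine h4.trans ?_
  rw [show 6 * (E / b) * (b' * b) = 6 * E * b' by field_simp]
  nlinarith

/-- A child with fewer than `4E` points may have a meaningless proportion, but its weight is at most
`4E/n`. For a larger child the entropy error `√(6E/(a+b))` times the weight `(a+b)/n` is at most
`√(6E/n)`. -/
theorem abs_noisy_term_sub_le {a b a' b' w' E n : ℝ} (hE : 0 ≤ E) (hn : 0 < n) (ha : 0 ≤ a)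
    (hb : 0 ≤ b) (hbn : a + b ≤ n) (ha' : |a' - a| ≤ E) (hb' : |b' - b| ≤ E)
    (hw' : |w' - (a + b) / n| ≤ 6 * (E / n)) :
    |w' * entropy (b' / (a' + b')) - (a + b) / n * entropy (b / (a + b))| ≤
      10 * (E / n) + 5 * √(6 * (E / n)) := by
  have hs := Real.sqrt_nonneg (6 * (E / n))
  have hw0 : 0 ≤ (a + b) / n := by positivity
  have e : w' * entropy (b' / (a' + b')) - (a + b) / n * entropy (b / (a + b)) =
      (w' - (a + b) / n) * entropy (b' / (a' + b')) +
      (a + b) / n * (entropy (b' / (a' + b')) - entropy (b / (a + b))) := by ring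
  have h1 : |(w' - (a + b) / n) * entropy (b' / (a' + b'))| ≤ 6 * (E / n) := by
    rw [abs_mul, abs_of_nonneg (entropy_nonneg _)]
    exact (mul_le_of_le_one_right (abs_nonneg _) (entropy_le_one _)).trans hw'
  have h2 : |(a + b) / n * (entropy (b' / (a' + b')) - entropy (b / (a + b)))| ≤
      4 * (E / n) + 5 * √(6 * (E / n)) := by
    rw [abs_mul, abs_of_nonneg hw0]
    have hEn : 0 ≤ E / n := by positivity
    rcases lt_or_ge (a + b) (4 * E) with h | h
    · have h3 : |entropy (b' / (a' + b')) - entropy (b / (a + b))| ≤ 1 := by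
        have := entropy_nonneg (b' / (a' + b'))
        have := entropy_le_one (b' / (a' + b'))
        have := entropy_nonneg (b / (a + b))
        have := entropy_le_one (b / (a + b))
        rw [abs_le]
        constructor <;> linarith
      have h4 : (a + b) / n ≤ 4 * (E / n) := by
        rw [← mul_div_assoc]
        exact div_le_div_of_nonneg_right h.le hn.le
      have := mul_le_mul_of_nonneg_left h3 hw0
      linarith
    · rcases eq_or_lt_of_le (add_nonneg ha hb) with h0 | h0
      · rw [← h0]
        simp only [zero_div, zero_mul]
        positivity
      · have h3 := abs_div_sub_div_le hE hb (by linarith : b ≤ a + b) h0 h hb'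
          (b' := a' + b') (by
            rw [show a' + b' - (a + b) = (a' - a) + (b' - b) by ring]
            linarith [abs_add_le (a' - a) (b' - b)])
        have h4 := (abs_entropy_sub_le (b' / (a' + b')) (b / (a + b))).trans
          (mul_le_mul_of_nonneg_left (Real.sqrt_le_sqrt h3) (by norm_num : (0 : ℝ) ≤ 5))
        have hw1 : (a + b) / n ≤ 1 := (div_le_one hn).2 hbn
        have h5 : (a + b) / n * √(6 * (E / (a + b))) ≤ √(6 * (E / n)) := by
          refine Real.le_sqrt_of_sq_le ?_
          rw [mul_pow, Real.sq_sqrt (by positivity)]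
          have : ((a + b) / n) ^ 2 * (6 * (E / (a + b))) = (a + b) / n * (6 * (E / n)) := by
            field_simp
          rw [this]
          exact mul_le_of_le_one_left (by positivity) hw1
        have := mul_le_mul_of_nonneg_left h4 hw0
        linarith
  rw [e]
  refine (abs_add_le _ _).trans ?_
  linarith

theorem abs_entropyDrop_sub_le {c cYH : Bool → Bool → ℝ} {cY cH : Bool → ℝ} {E n : ℝ}
    (hc : ∀ a b, 0 ≤ c a b)
    (hn : c false false + c false true + (c true false + c true true) = n) (hn0 : 0 < n)
    (hE : 0 ≤ E) (hEn : 4 * E ≤ n) (hY : ∀ a, |cY a - (c a false + c a true)| ≤ E)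
    (hH : ∀ b, |cH b - (c false b + c true b)| ≤ E) (hYH : ∀ a b, |cYH a b - c a b| ≤ E) :
    |entropyDrop cY cH cYH - exactDrop c| ≤ 50 * √(E / n) := by
  have hm : |cY false + cY true - n| ≤ 2 * E := by
    rw [← hn, show cY false + cY true - (c false false + c false true + (c true false + c true true))
      = (cY false - (c false false + c false true)) + (cY true - (c true false + c true true)) by ring]
    linarith [abs_add_le (cY false - (c false false + c false true))
      (cY true - (c true false + c true true)), hY false, hY true]
  have hq := abs_div_sub_div_le hE (add_nonneg (hc true false) (hc true true))
    (by linarith [hc false false, hc false true]) hn0 hEn (hY true) hm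
  have hw : ∀ b, |cH b / (cY false + cY true) - (c false b + c true b) / n| ≤ 6 * (E / n) := by
    intro b
    refine abs_div_sub_div_le hE (add_nonneg (hc _ _) (hc _ _)) ?_ hn0 hEn (hH b) hm
    cases b <;> linarith [hc false false, hc false true, hc true false, hc true true]
  have ht : ∀ b, |cH b / (cY false + cY true) * entropy (cYH true b / (cYH false b + cYH true b)) -
      (c false b + c true b) / n * entropy (c true b / (c false b + c true b))| ≤
      10 * (E / n) + 5 * √(6 * (E / n)) := by
    intro b
    refine abs_noisy_term_sub_le hE hn0 (hc _ _) (hc _ _) ?_ (hYH _ _) (hYH _ _) (hw b)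
    cases b <;> linarith [hc false false, hc false true, hc true false, hc true true]
  have hr := (abs_entropy_sub_le _ _).trans
    (mul_le_mul_of_nonneg_left (Real.sqrt_le_sqrt hq) (by norm_num : (0 : ℝ) ≤ 5))
  have he0 : 0 ≤ E / n := by positivity
  have he1 : E / n ≤ 1 / 4 := by rw [div_le_iff₀ hn0]; linarith
  have hsq := Real.sq_sqrt he0
  have hs0 := Real.sqrt_nonneg (E / n)
  have hs1 : √(E / n) ≤ 1 / 2 := Real.sqrt_le_iff.2 ⟨by norm_num, by linarith⟩
  have h6 : √(6 * (E / n)) ≤ 5 / 2 * √(E / n) := by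
    rw [Real.sqrt_mul (by norm_num)]
    exact mul_le_mul_of_nonneg_right (Real.sqrt_le_iff.2 ⟨by norm_num, by norm_num⟩) hs0
  -- The total is `20 x + 15 √(6x)` with `x = E/n ≤ 1/4`, at most `(10 + 37.5) √x`.
  have h7 : E / n ≤ 1 / 2 * √(E / n) := by nlinarith
  rw [exactDrop, entropyDrop, entropyDrop]
  simp only [Fintype.sum_bool, hn]
  have t0 := ht false
  have t1 := ht true
  rw [abs_le] at *
  constructor <;> linarith

variable {X : Type*} {k : ℕ}

/-! ### Exact counts -/

/-- The number of points of `D` that satisfy `p`. -/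
noncomputable def cnt (p : X → Bool) (D : Multiset X) : ℝ := (D.countP fun x => p x = true : ℕ)

/-- The number of points of `D` with label `a` that are sent to child `b` by `h`. -/
noncomputable def cell (f h : X → Bool) (D : Multiset X) (a b : Bool) : ℝ :=
  cnt (fun x => f x == a && h x == b) D

/-- The entropy of the labels at a node with data `D`, times the size of `D`. -/
noncomputable def nodeEntropy (f : X → Bool) (D : Multiset X) : ℝ :=
  D.card * entropy (cnt (fun x => f x == true) D / D.card)

theorem cnt_nonneg (p : X → Bool) (D : Multiset X) : 0 ≤ cnt p D := Nat.cast_nonneg _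

theorem cell_nonneg (f h : X → Bool) (D : Multiset X) (a b : Bool) : 0 ≤ cell f h D a b :=
  cnt_nonneg _ _

theorem cnt_le_card (p : X → Bool) (D : Multiset X) : cnt p D ≤ D.card :=
  Nat.cast_le.2 (Multiset.countP_le_card _ _)

theorem cnt_true (D : Multiset X) : cnt (fun _ => true) D = D.card := by
  simp [cnt]

/-- One induction that serves all the partition identities for counts. -/
theorem cnt_add_of_toNat {p q r : X → Bool} (h : ∀ x, (p x).toNat = (q x).toNat + (r x).toNat)
    (D : Multiset X) : cnt p D = cnt q D + cnt r D := by
  unfold cnt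
  norm_cast
  induction D using Multiset.induction_on with
  | empty => simp
  | cons x D ih =>
    have hx := h x
    simp only [Multiset.countP_cons]
    revert hx
    rcases p x <;> rcases q x <;> rcases r x <;> simp <;> omega

theorem cnt_label (f h : X → Bool) (D : Multiset X) (a : Bool) :
    cnt (fun x => f x == a) D = cell f h D a false + cell f h D a true :=
  cnt_add_of_toNat (fun x => by rcases f x <;> rcases h x <;> rcases a <;> rfl) D

theorem cnt_split (f h : X → Bool) (D : Multiset X) (b : Bool) :
    cnt (fun x => h x == b) D = cell f h D false b + cell f h D true b :=
  cnt_add_of_toNat (fun x => by rcases f x <;> rcases h x <;> rcases b <;> rfl) D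

theorem card_eq_cnt (f : X → Bool) (D : Multiset X) :
    (D.card : ℝ) = cnt (fun x => f x == false) D + cnt (fun x => f x == true) D := by
  rw [← cnt_true]
  exact cnt_add_of_toNat (fun x => by rcases f x <;> rfl) D

theorem card_eq_cell (f h : X → Bool) (D : Multiset X) :
    cell f h D false false + cell f h D false true +
      (cell f h D true false + cell f h D true true) = D.card := by
  rw [card_eq_cnt f, cnt_label f h, cnt_label f h]

theorem cnt_filter (p q : X → Bool) (D : Multiset X) :
    cnt p (D.filter fun x => q x = true) = cnt (fun x => p x && q x) D := by
  simp [cnt, Multiset.countP_filter]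

theorem cnt_sum (p : X → Bool) (S : Fin k → Multiset X) :
    cnt p (∑ j, S j) = ∑ j, cnt p (S j) := by
  unfold cnt
  rw [← Nat.cast_sum]
  congr 1
  exact map_sum (Multiset.countPAddMonoidHom fun x => p x = true) S Finset.univ

theorem nodeEntropy_nonneg (f : X → Bool) (D : Multiset X) : 0 ≤ nodeEntropy f D :=
  mul_nonneg (Nat.cast_nonneg _) (entropy_nonneg _)

theorem nodeEntropy_le_card (f : X → Bool) (D : Multiset X) : nodeEntropy f D ≤ D.card :=
  mul_le_of_le_one_right (Nat.cast_nonneg _) (entropy_le_one _)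

theorem two_mul_min_cnt_le_nodeEntropy (f : X → Bool) (D : Multiset X) :
    2 * min (cnt (fun x => f x == false) D) (cnt (fun x => f x == true) D) ≤ nodeEntropy f D := by
  have h0 := cnt_nonneg (fun x => f x == false) D
  have h1 := cnt_nonneg (fun x => f x == true) D
  rw [nodeEntropy, card_eq_cnt f]
  set a := cnt (fun x => f x == false) D
  set b := cnt (fun x => f x == true) D
  rcases eq_or_lt_of_le (add_nonneg h0 h1) with h | h
  · have ha : a = 0 := by linarith
    have hb : b = 0 := by linarith
    simp [ha, hb]
  · have := mul_le_mul_of_nonneg_left (two_mul_min_le_entropy (q := b / (a + b))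
      (by positivity) ((div_le_one h).2 (by linarith))) h.le
    refine le_trans (le_of_eq ?_) this
    have e : 1 - b / (a + b) = a / (a + b) := by field_simp; ring
    rw [e, min_div_div_right h.le, min_comm a b]
    field_simp

theorem card_mul_exactDrop (f h : X → Bool) {D : Multiset X} (hD : D ≠ 0) :
    D.card * exactDrop (cell f h D) = nodeEntropy f D -
      (nodeEntropy f (D.filter fun x => (h x == false) = true) +
        nodeEntropy f (D.filter fun x => (h x == true) = true)) := by
  have hn : (D.card : ℝ) ≠ 0 := by
    simpa using hD
  rw [mul_exactDrop (card_eq_cell f h D) hn, nodeEntropy, nodeEntropy, nodeEntropy,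
    card_eq_cnt f (D.filter _), card_eq_cnt f (D.filter _)]
  simp only [cnt_filter, cnt_label f h D true]
  rfl

/-! ### Weak learning on finite data -/

theorem tsum_count_eq_card [DecidableEq X] (W : Multiset X) :
    (∑' x : X, (W.count x : ENNReal)) = W.card := by
  rw [tsum_eq_sum (s := W.toFinset) (fun x hx => by simpa using hx)]
  rw [← Nat.cast_sum, Multiset.toFinset_sum_count_eq]

/-- The assumption is used for the empirical distribution of `W`, multiplicities included. -/
theorem WeakLearning.exists_cnt_le {H : Finset (X → Bool)} {f : X → Bool} {γ : ℝ}
    (hw : WeakLearning H f γ) {W : Multiset X} (hW : W ≠ 0) :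
    ∃ h ∈ H, cnt (fun x => h x != f x) W ≤ (1 / 2 - γ) * W.card := by
  classical
  obtain ⟨h, hh, hle⟩ := hw (PMF.ofMultiset W hW)
  refine ⟨h, hh, ?_⟩
  rw [PMF.toOuterMeasure_ofMultiset_apply] at hle
  have hc : (0 : ℝ) < W.card := by
    exact_mod_cast Multiset.card_pos.2 hW
  have e := tsum_count_eq_card (W.filter fun x => x ∈ {x | h x ≠ f x})
  have e2 : ((W.filter fun x => x ∈ {x | h x ≠ f x}).card : ℝ) = cnt (fun x => h x != f x) W := by
    rw [cnt, Multiset.countP_eq_card_filter]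
    congr 2
    apply Multiset.filter_congr
    intro x _
    simp
  rw [ENNReal.toReal_div, ENNReal.toReal_natCast, div_le_iff₀ hc] at hle
  rw [← e2]
  refine le_trans (le_of_eq ?_) hle
  rw [← ENNReal.toReal_natCast, ← e]
  congr!

theorem WeakLearning.le_half {H : Finset (X → Bool)} {f : X → Bool} {γ : ℝ}
    (hw : WeakLearning H f γ) (x : X) : γ ≤ 1 / 2 := by
  obtain ⟨h, -, hle⟩ := hw.exists_cnt_le (W := {x}) (by simp)
  have := cnt_nonneg (fun x => h x != f x) {x}
  simp only [Multiset.card_singleton] at hle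
  push_cast at hle
  linarith

theorem cnt_add (p : X → Bool) (D D' : Multiset X) : cnt p (D + D') = cnt p D + cnt p D' := by
  simp [cnt]

theorem cnt_nsmul (p : X → Bool) (n : ℕ) (D : Multiset X) : cnt p (n • D) = n * cnt p D := by
  simp [cnt, Multiset.countP_nsmul]

/-- At a node that contains points of both classes, some `h ∈ H` has a large drop in entropy. -/
theorem WeakLearning.exists_le_exactDrop {H : Finset (X → Bool)} {f : X → Bool} {γ : ℝ}
    (hγ : 0 ≤ γ) (hw : WeakLearning H f γ) {D : Multiset X}
    (h0 : 0 < cnt (fun x => f x == false) D) (h1 : 0 < cnt (fun x => f x == true) D) :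
    ∃ h ∈ H, 8 * γ ^ 2 * (cnt (fun x => f x == true) D / D.card *
      (1 - cnt (fun x => f x == true) D / D.card)) ≤ exactDrop (cell f h D) * Real.log 2 := by
  set D₀ := D.filter fun x => (f x == false) = true with hD₀
  set D₁ := D.filter fun x => (f x == true) = true with hD₁
  have c0 : cnt (fun x => f x == false) D = D₀.card := by
    rw [cnt, Multiset.countP_eq_card_filter]
  have c1 : cnt (fun x => f x == true) D = D₁.card := by
    rw [cnt, Multiset.countP_eq_card_filter]
  -- The balanced sample: each class is replicated as often as the other has points. Without
  -- balancing, a constant `h` could meet the weak learning bound and yet have drop zero.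
  have hpos : 0 < (D₁.card • D₀ + D₀.card • D₁).card := by
    rw [c0] at h0
    rw [c1] at h1
    have h0' : 0 < D₀.card := by exact_mod_cast h0
    have h1' : 0 < D₁.card := by exact_mod_cast h1
    rw [Multiset.card_add, Multiset.card_nsmul]
    positivity
  obtain ⟨h, hh, hle⟩ := hw.exists_cnt_le (Multiset.card_pos.1 hpos)
  refine ⟨h, hh, ?_⟩
  rw [cnt_add, cnt_nsmul, cnt_nsmul, hD₀, hD₁, cnt_filter, cnt_filter, ← hD₀, ← hD₁] at hle
  have k0 : (fun x => (h x != f x) && f x == false) = fun x => f x == false && h x == true := by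
    funext x
    rcases f x <;> rcases h x <;> rfl
  have k1 : (fun x => (h x != f x) && f x == true) = fun x => f x == true && h x == false := by
    funext x
    rcases f x <;> rcases h x <;> rfl
  rw [k0, k1, Multiset.card_add, Multiset.card_nsmul, Multiset.card_nsmul] at hle
  push_cast at hle
  rw [← c0, ← c1] at hle
  rw [card_eq_cnt f]
  refine le_exactDrop (cell_nonneg f h D) hγ (cnt_label f h D false).symm
    (cnt_label f h D true).symm h0 h1 (hle.trans (le_of_eq ?_))
  ring

/-- The weak learning guarantee at a node whose entropy is not tiny. -/
theorem WeakLearning.exists_nodeEntropy_le {H : Finset (X → Bool)} {f : X → Bool} {γ l : ℝ}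
    (hγ : 0 ≤ γ) (hw : WeakLearning H f γ) {D : Multiset X} (hD : D ≠ 0) (hl : 1 / 2 ≤ l)
    (hbig : Real.exp (-l) / 10 * D.card ≤ nodeEntropy f D) :
    ∃ h ∈ H, γ ^ 2 / (6 * l) * nodeEntropy f D ≤ D.card * exactDrop (cell f h D) := by
  have hn : (0 : ℝ) < D.card := by exact_mod_cast Multiset.card_pos.2 hD
  have hlog := Real.log_two_gt_d9
  set q := cnt (fun x => f x == true) D / D.card with hq
  have q0 : 0 ≤ q := div_nonneg (cnt_nonneg _ _) hn.le
  have q1 : q ≤ 1 := (div_le_one hn).2 (cnt_le_card _ _)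
  have hne : nodeEntropy f D = D.card * (Real.binEntropy q / Real.log 2) := by
    rw [nodeEntropy, entropy_of_mem q0 q1]
  have hG : Real.exp (-l) / 10 ≤ Real.binEntropy q / Real.log 2 := by
    rw [hne, mul_comm] at hbig
    exact le_of_mul_le_mul_left hbig hn
  have he := Real.exp_pos (-l)
  -- Change of base, with `log 2 ≥ 1/2`. The final constant `1/6` is below the available `8/42`.
  have hb : Real.exp (-l) / 20 ≤ Real.binEntropy q := by
    rw [le_div_iff₀ (by linarith)] at hG
    nlinarith
  have hB := binEntropy_le_mul_log q0 q1 hl hb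
  have hqq : 0 < q * (1 - q) := by
    have : 0 < Real.binEntropy q := lt_of_lt_of_le (by positivity) hb
    by_contra hcon
    have : 42 * l * (q * (1 - q)) ≤ 0 :=
      mul_nonpos_of_nonneg_of_nonpos (by linarith) (not_lt.1 hcon)
    linarith
  have hq0 : 0 < q := lt_of_le_of_ne q0 (fun h => by rw [← h] at hqq; simp at hqq)
  have hq1 : 0 < 1 - q := lt_of_le_of_ne (by linarith) (fun h => by rw [← h] at hqq; simp at hqq)
  have e1 : cnt (fun x => f x == true) D = q * D.card := by rw [hq]; field_simp
  have e0 : cnt (fun x => f x == false) D = (1 - q) * D.card := by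
    have := card_eq_cnt f D
    linarith
  obtain ⟨h, hh, hle⟩ := hw.exists_le_exactDrop hγ (D := D) (by rw [e0]; positivity)
    (by rw [e1]; positivity)
  refine ⟨h, hh, ?_⟩
  rw [← hq] at hle
  rw [hne, mul_left_comm]
  refine mul_le_mul_of_nonneg_left ?_ hn.le
  have hl0 : 0 < l := by linarith
  rw [← mul_div_assoc, div_le_iff₀ (by linarith), div_mul_eq_mul_div, div_le_iff₀ (by positivity)]
  have t1 : γ ^ 2 * Real.binEntropy q ≤ γ ^ 2 * (42 * l * (q * (1 - q))) :=
    mul_le_mul_of_nonneg_left hB (sq_nonneg _)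
  have t2 : 0 ≤ γ ^ 2 * (q * (1 - q)) * l := by positivity
  have t3 := mul_le_mul_of_nonneg_right hle hl0.le
  nlinarith

/-! ### Bounded noise -/

open Classical in
/-- The queries that are made at a node. -/
noncomputable def queries (H : Finset (X → Bool)) : Finset (Query X) :=
  {.weight} ∪ Finset.univ.image .label ∪ (H ×ˢ Finset.univ).image (fun q => .countY q.1 q.2) ∪
    (H ×ˢ Finset.univ).image (fun q => .countH q.1 q.2) ∪
    (H ×ˢ (Finset.univ : Finset (Bool × Bool))).image (fun q => .countYH q.1 q.2.1 q.2.2)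

theorem card_queries_le (H : Finset (X → Bool)) : (queries H).card ≤ 3 + 8 * H.card := by
  classical
  unfold queries
  refine (Finset.card_union_le _ _).trans ?_
  have h1 := Finset.card_image_le (s := H ×ˢ (Finset.univ : Finset (Bool × Bool)))
    (f := fun q => Query.countYH q.1 q.2.1 q.2.2)
  refine (add_le_add (Finset.card_union_le _ _) h1).trans ?_
  have h2 := Finset.card_image_le (s := H ×ˢ (Finset.univ : Finset Bool))
    (f := fun q => Query.countH q.1 q.2)
  refine (add_le_add (add_le_add (Finset.card_union_le _ _) h2) le_rfl).trans ?_
  have h3 := Finset.card_image_le (s := H ×ˢ (Finset.univ : Finset Bool))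
    (f := fun q => Query.countY q.1 q.2)
  refine (add_le_add (add_le_add (add_le_add (Finset.card_union_le _ _) h3) le_rfl) le_rfl).trans ?_
  have h4 := Finset.card_image_le (s := (Finset.univ : Finset Bool)) (f := Query.label (X := X))
  simp only [Finset.card_product, Finset.card_univ, Fintype.card_prod, Fintype.card_bool,
    Finset.card_singleton] at *
  omega

/-- All the noise that the first `M` iterations use is at most `L` in absolute value. -/
def NoiseBounded (H : Finset (X → Bool)) (M : ℕ) (L : ℝ) (ω : Noise k X) : Prop :=
  ∀ v < 2 * M + 1, ∀ j, ∀ c ∈ queries H, |ω (v, j, c)| ≤ L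

/-- The triangle inequality over the holders costs a factor `k`, which the sample size can afford;
no cancellation is needed. -/
theorem abs_noisyCount_sub_le {ω : Noise k X} {v : ℕ} {c : Query X} {L s : ℝ}
    (hω : ∀ j, |ω (v, j, c)| ≤ L) (hs : 0 ≤ s) (D : Fin k → Multiset X) (p : X → Bool) :
    |noisyCount ω v D c s p - cnt p (∑ j, D j)| ≤ s * (k * L) := by
  have e : noisyCount ω v D c s p - cnt p (∑ j, D j) = s * ∑ j, ω (v, j, c) := by
    rw [cnt_sum, noisyCount, Finset.sum_add_distrib, Finset.mul_sum]
    exact add_sub_cancel_left _ _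
  rw [e, abs_mul, abs_of_nonneg hs]
  refine mul_le_mul_of_nonneg_left ?_ hs
  refine (Finset.abs_sum_le_sum_abs _ _).trans ?_
  refine (Finset.sum_le_card_nsmul _ _ L fun j _ => hω j).trans ?_
  simp

theorem abs_noisyDrop_sub_le {H : Finset (X → Bool)} {f h : X → Bool} {ω : Noise k X} {M v : ℕ}
    {L E α' : ℝ} (hω : NoiseBounded H M L ω) (hv : v < 2 * M + 1) (hh : h ∈ H) (hα' : 0 ≤ α')
    (hL : 0 ≤ L) (D : Fin k → Multiset X) (hD : ∑ j, D j ≠ 0)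
    (hE : 3 * H.card / α' * (k * L) ≤ E) (hED : 4 * E ≤ (∑ j, D j).card) :
    |noisyDrop H f ω v D α' h - exactDrop (cell f h (∑ j, D j))| ≤
      50 * √(E / (∑ j, D j).card) := by
  have hs : (0 : ℝ) ≤ 3 * H.card / α' := by positivity
  have hE0 : 0 ≤ E := le_trans (by positivity) hE
  have hn : (0 : ℝ) < (∑ j, D j).card := by exact_mod_cast Multiset.card_pos.2 hD
  refine abs_entropyDrop_sub_le (cell_nonneg f h _) (card_eq_cell f h _) hn hE0 hED ?_ ?_ ?_
  · intro a
    rw [← cnt_label]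
    refine (abs_noisyCount_sub_le (fun j => hω v hv j _ ?_) hs D _).trans hE
    simp [queries, hh]
  · intro b
    rw [← cnt_split]
    refine (abs_noisyCount_sub_le (fun j => hω v hv j _ ?_) hs D _).trans hE
    simp [queries, hh]
  · intro a b
    refine (abs_noisyCount_sub_le (fun j => hω v hv j _ ?_) hs D _).trans hE
    simp [queries, hh]

theorem noisyCounts_spec (H : Finset (X → Bool)) (hH : H.Nonempty) (f : X → Bool)
    (ω : Noise k X) (v : ℕ) (D : Fin k → Multiset X) (α' : ℝ) :
    (noisyCounts H hH f ω v D α').1 ∈ H ∧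
      (noisyCounts H hH f ω v D α').2 = noisyDrop H f ω v D α' (noisyCounts H hH f ω v D α').1 ∧
      ∀ h ∈ H, noisyDrop H f ω v D α' h ≤ (noisyCounts H hH f ω v D α').2 := by
  have := (H.exists_max_image (noisyDrop H f ω v D α') hH).choose_spec
  exact ⟨this.1, rfl, this.2⟩

/-- A queue element for a leaf with data `D`, out of `m` points in total, whose priority is
accurate up to `ξ`. -/
structure GoodItem (H : Finset (X → Bool)) (f : X → Bool) (m ξ : ℝ) (D : Multiset X)
    (e : Item X) : Prop where
  mem : e.split ∈ H
  ne_zero : D ≠ 0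
  le_drop : m * (e.priority - ξ) ≤ D.card * exactDrop (cell f e.split D)
  drop_le : ∀ h ∈ H, D.card * exactDrop (cell f h D) ≤ m * (e.priority + ξ)

/-- The relative noise grows as the node shrinks, but `n/m * √(η m/n) ≤ √η`, so the weighted drop
has an error bound independent of `n`. -/
theorem abs_weighted_sub_le {w n m J J' η : ℝ} (hη : 0 ≤ η) (hn : 0 < n) (hnm : n ≤ m)
    (hηn : 4 * (η * m) ≤ n) (hw0 : 0 ≤ w) (hw : |w - n / m| ≤ η) (hJ : |J| ≤ 1)
    (hJ' : |J' - J| ≤ 50 * √(η * m / n)) : |w * J' - n / m * J| ≤ 101 * √η := by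
  have hm : 0 < m := lt_of_lt_of_le hn hnm
  have hs := Real.sqrt_nonneg (η * m / n)
  have h1 : √(η * m / n) ≤ 1 / 2 := by
    refine Real.sqrt_le_iff.2 ⟨by norm_num, ?_⟩
    rw [div_le_iff₀ hn]
    linarith
  have h2 : n / m * √(η * m / n) ≤ √η := by
    refine Real.le_sqrt_of_sq_le ?_
    rw [mul_pow, Real.sq_sqrt (by positivity)]
    have : (n / m) ^ 2 * (η * m / n) = n / m * η := by field_simp
    rw [this]
    exact mul_le_of_le_one_left hη ((div_le_one hm).2 hnm)
  have hη1 : η ≤ 1 := by nlinarith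
  have h3 : η ≤ √η := Real.le_sqrt_of_sq_le (by nlinarith)
  have e : w * J' - n / m * J = w * (J' - J) + (w - n / m) * J := by ring
  rw [e]
  refine (abs_add_le _ _).trans ?_
  rw [abs_mul, abs_mul, abs_of_nonneg hw0]
  have h4 : |w - n / m| * |J| ≤ η := (mul_le_of_le_one_right (abs_nonneg _) hJ).trans hw
  have h5 : w ≤ n / m + η := by linarith [(abs_le.1 hw).2]
  have h6 : w * |J' - J| ≤ (n / m + η) * (50 * √(η * m / n)) :=
    mul_le_mul h5 hJ' (abs_nonneg _) (by positivity)
  nlinarith [mul_le_mul_of_nonneg_left h1 hη]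

/-- The estimate is used twice: for the chosen split, and for every competitor, whose noisy drop is
no larger and stays so after multiplication by `w ≥ 0`. -/
theorem goodItem_of_noiseBounded {H : Finset (X → Bool)} (hH : H.Nonempty) {f : X → Bool}
    {ω : Noise k X} {M v : ℕ} {L η m w α' : ℝ} (hω : NoiseBounded H M L ω) (hv : v < 2 * M + 1)
    (hα' : 0 ≤ α') (hL : 0 ≤ L) (D : Fin k → Multiset X) (hD : ∑ j, D j ≠ 0) (hη : 0 ≤ η)
    (hE : 3 * H.card / α' * (k * L) ≤ η * m) (hED : 4 * (η * m) ≤ (∑ j, D j).card)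
    (hDm : (∑ j, D j).card ≤ m) (hw0 : 0 ≤ w) (hw : |w - (∑ j, D j).card / m| ≤ η) (d : ℕ) :
    GoodItem H f m (101 * √η) (∑ j, D j)
      ⟨v, d, (noisyCounts H hH f ω v D α').1, w * (noisyCounts H hH f ω v D α').2⟩ := by
  obtain ⟨h1, h2, h3⟩ := noisyCounts_spec H hH f ω v D α'
  have hn : (0 : ℝ) < (∑ j, D j).card := by exact_mod_cast Multiset.card_pos.2 hD
  have hm := lt_of_lt_of_le hn hDm
  have key : ∀ h ∈ H, |w * noisyDrop H f ω v D α' h -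
      (∑ j, D j).card / m * exactDrop (cell f h (∑ j, D j))| ≤ 101 * √η := fun h hh =>
    abs_weighted_sub_le hη hn hDm hED hw0 hw
      (abs_exactDrop_le_one (cell_nonneg _ _ _) (card_eq_cell _ _ _) hn)
      (abs_noisyDrop_sub_le hω hv hh hα' hL D hD hE hED)
  have e : ∀ J : ℝ, (∑ j, D j).card * J = m * ((∑ j, D j).card / m * J) := by
    intro J
    field_simp
  refine ⟨h1, hD, ?_, ?_⟩
  · rw [e]
    refine mul_le_mul_of_nonneg_left ?_ hm.le
    have := (abs_le.1 (key _ h1)).2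
    rw [← h2] at this
    dsimp only
    linarith
  · intro h hh
    rw [e]
    refine mul_le_mul_of_nonneg_left ?_ hm.le
    have := (abs_le.1 (key _ hh)).1
    have := mul_le_mul_of_nonneg_left (h3 h hh) hw0
    dsimp only
    linarith

/-! ### The data at a node -/

/-- The data of all the holders at leaf `v`. -/
def nodeData (S : Fin k → Multiset X) (T : Tree X) (v : ℕ) : Multiset X :=
  (∑ j, S j).filter fun x => T.route x = v

theorem sum_leafData (S : Fin k → Multiset X) (T : Tree X) (v : ℕ) :
    ∑ j, leafData S T v j = nodeData S T v := by
  exact (map_sum (⟨⟨Multiset.filter fun x => T.route x = v, Multiset.filter_zero _⟩,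
    Multiset.filter_add _⟩ : Multiset X →+ Multiset X) S Finset.univ).symm

theorem card_sum_eq_dataSize (S : Fin k → Multiset X) : (∑ j, S j).card = dataSize S :=
  Multiset.card_sum _ _

theorem card_nodeData_le (S : Fin k → Multiset X) (T : Tree X) (v : ℕ) :
    (nodeData S T v).card ≤ dataSize S := by
  rw [← card_sum_eq_dataSize]
  exact Multiset.card_le_card (Multiset.filter_le _ _)

theorem Tree.route_split (v : ℕ) (h : X → Bool) (v₀ v₁ : ℕ) (T : Tree X) (x : X) :
    (T.split v h v₀ v₁).route x =
      if T.route x = v then (if h x then v₁ else v₀) else T.route x := by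
  induction T with
  | leaf u => by_cases hu : u = v <;> simp [Tree.split, Tree.route, hu]
  | node g l r ihl ihr =>
    simp only [Tree.split, Tree.route]
    by_cases hg : g x = true <;> simp [hg, ihl, ihr]

theorem nodeData_split_of_ne {S : Fin k → Multiset X} {T : Tree X} {v v₀ v₁ u : ℕ} {h : X → Bool}
    (hv : u ≠ v) (h₀ : u ≠ v₀) (h₁ : u ≠ v₁) :
    nodeData S (T.split v h v₀ v₁) u = nodeData S T u := by
  refine Multiset.filter_congr fun x _ => ?_
  rw [Tree.route_split]
  by_cases hx : T.route x = v
  · cases h x <;> simp [hx, hv.symm, h₀.symm, h₁.symm]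
  · simp [hx]

theorem nodeData_split_left {S : Fin k → Multiset X} {T : Tree X} {v v₀ v₁ : ℕ} {h : X → Bool}
    (h₀ : ∀ x, T.route x ≠ v₀) (h₁ : v₁ ≠ v₀) :
    nodeData S (T.split v h v₀ v₁) v₀ =
      (nodeData S T v).filter fun x => (h x == false) = true := by
  rw [nodeData, nodeData, Multiset.filter_filter]
  refine Multiset.filter_congr fun x _ => ?_
  rw [Tree.route_split]
  by_cases hx : T.route x = v
  · cases h x <;> simp [hx, h₁]
  · simp [hx, h₀ x]

theorem nodeData_split_right {S : Fin k → Multiset X} {T : Tree X} {v v₀ v₁ : ℕ} {h : X → Bool}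
    (h₀ : ∀ x, T.route x ≠ v₁) (h₁ : v₀ ≠ v₁) :
    nodeData S (T.split v h v₀ v₁) v₁ =
      (nodeData S T v).filter fun x => (h x == true) = true := by
  rw [nodeData, nodeData, Multiset.filter_filter]
  refine Multiset.filter_congr fun x _ => ?_
  rw [Tree.route_split]
  by_cases hx : T.route x = v
  · cases h x <;> simp [hx, h₁]
  · simp [hx, h₀ x]

/-- The entropy of the labels given the leaf in `A`, times the number of points. -/
noncomputable def potential (f : X → Bool) (S : Fin k → Multiset X) (T : Tree X)
    (A : Finset ℕ) : ℝ :=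
  ∑ v ∈ A, nodeEntropy f (nodeData S T v)

/-- The new names are fresh, so only the summand of the split leaf changes. -/
theorem potential_split {f h : X → Bool} {S : Fin k → Multiset X} {T : Tree X} {A : Finset ℕ}
    {v v₀ v₁ : ℕ} (hA : ∀ x, T.route x ∈ A) (hv : v ∈ A) (h₀ : v₀ ∉ A) (h₁ : v₁ ∉ A)
    (h₀₁ : v₀ ≠ v₁) (hD : nodeData S T v ≠ 0) :
    potential f S (T.split v h v₀ v₁) (insert v₀ (insert v₁ (A.erase v))) =
      potential f S T A -
        (nodeData S T v).card * exactDrop (cell f h (nodeData S T v)) := by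
  have r₀ : ∀ x, T.route x ≠ v₀ := fun x hx => h₀ (hx ▸ hA x)
  have r₁ : ∀ x, T.route x ≠ v₁ := fun x hx => h₁ (hx ▸ hA x)
  rw [card_mul_exactDrop f h hD, potential, potential, Finset.sum_insert (by simp [h₀₁, h₀]),
    Finset.sum_insert (by simp [h₁]), ← Finset.add_sum_erase _ _ hv,
    nodeData_split_left r₀ h₀₁.symm, nodeData_split_right r₁ h₀₁]
  have : ∑ u ∈ A.erase v, nodeEntropy f (nodeData S (T.split v h v₀ v₁) u) =
      ∑ u ∈ A.erase v, nodeEntropy f (nodeData S T u) := by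
    refine Finset.sum_congr rfl fun u hu => ?_
    have hu' := Finset.mem_of_mem_erase hu
    rw [nodeData_split_of_ne (Finset.ne_of_mem_erase hu) (ne_of_mem_of_not_mem hu' h₀)
      (ne_of_mem_of_not_mem hu' h₁)]
  rw [this]
  ring

/-! ### The invariant of the main loop -/

/-- The noise is so small, compared with the data, that every count is off by at most
`η * dataSize S`. -/
structure SmallNoise (H : Finset (X → Bool)) (S : Fin k → Multiset X) (M : ℕ) (ε α L η : ℝ)
    (ω : Noise k X) : Prop where
  M_pos : 0 < M
  α_pos : 0 < α
  L_nonneg : 0 ≤ L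
  bounded : NoiseBounded H M L ω
  size_pos : 0 < dataSize S
  noise_le : 12 * M * H.card / α * (k * L) ≤ η * dataSize S
  η_nonneg : 0 ≤ η
  η_le : 40 * M * η ≤ ε
  ε_le : ε ≤ 1
  ε_pos : 0 < ε

/-- After `t` iterations, the leaves have their names in `A`; the queue elements are accurate; and
leaves that are not queued have little data. -/
structure Invariant (H : Finset (X → Bool)) (f : X → Bool) (S : Fin k → Multiset X) (M : ℕ)
    (ε η : ℝ) (t : ℕ) (s : State X) (A : Finset ℕ) : Prop where
  route_mem : ∀ x, s.tree.route x ∈ A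
  lt : ∀ v ∈ A, v < 2 * t + 1
  card_le : A.card ≤ t + 1
  leaf_mem : ∀ e ∈ s.queue, e.leaf ∈ A
  good : ∀ e ∈ s.queue, GoodItem H f (dataSize S) (101 * √η) (nodeData S s.tree e.leaf) e
  queued : ∀ v ∈ A, (∃ e ∈ s.queue, e.leaf = v) ∨
    ((nodeData S s.tree v).card : ℝ) ≤ dataSize S * (ε / M + η)

section

variable {H : Finset (X → Bool)} {f : X → Bool} {S : Fin k → Multiset X} {M : ℕ} {ε α L η : ℝ}
  {ω : Noise k X}

theorem SmallNoise.size_pos' (h : SmallNoise H S M ε α L η ω) : (0 : ℝ) < dataSize S :=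
  Nat.cast_pos.2 h.size_pos

theorem SmallNoise.M_pos' (h : SmallNoise H S M ε α L η ω) : (0 : ℝ) < M :=
  Nat.cast_pos.2 h.M_pos

theorem SmallNoise.forty_mul_le (h : SmallNoise H S M ε α L η ω) : 40 * η ≤ ε / M := by
  rw [le_div_iff₀ h.M_pos']
  linarith [h.η_le]

/-- `12 M |H| / α` is the largest scale in a run: NoisyCounts at a new leaf has budget `α/(4M)`. The
other scales are `6 M |H| / α` at the root, `4M/α` for weights and `4/α` for labels. -/
theorem SmallNoise.scale_le (h : SmallNoise H S M ε α L η ω) {s : ℝ}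
    (hs : s ≤ 12 * M * H.card / α) : s * (k * L) ≤ η * dataSize S :=
  (mul_le_mul_of_nonneg_right hs (mul_nonneg (Nat.cast_nonneg _) h.L_nonneg)).trans h.noise_le

theorem SmallNoise.invariant_init (h : SmallNoise H S M ε α L η ω) (hH : H.Nonempty) :
    Invariant H f S M ε η 0 (initState (noisyCounts H hH f ω) (uniformBudget M) S α) {0} := by
  have hm := h.size_pos'
  have hM := h.M_pos'
  have hM1 : (1 : ℝ) ≤ M := by exact_mod_cast h.M_pos
  have hα := h.α_pos
  have hall : nodeData S (Tree.leaf 0) 0 = ∑ j, S j := by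
    simp [nodeData, Tree.route]
  have hcard := card_sum_eq_dataSize S
  refine ⟨fun x => by simp [initState, Tree.route], by simp, by simp, by simp [initState], ?_, ?_⟩
  · intro e he
    simp only [initState, List.mem_singleton] at he
    subst he
    have hne : (∑ j, S j) ≠ 0 := by
      rw [← Multiset.card_pos, hcard]
      exact h.size_pos
    have hη : 40 * η ≤ 1 := by
      have := h.forty_mul_le
      have := (div_le_one hM).2 (h.ε_le.trans hM1)
      linarith
    -- The priority of the root is its bare drop, that is, its weight is exactly `1`.
    have := goodItem_of_noiseBounded hH (f := f) (w := 1) (m := dataSize S)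
      (α' := α / 2 * uniformBudget M 1) h.bounded
      (Nat.succ_pos _ : 0 < 2 * M + 1) (by unfold uniformBudget; positivity) h.L_nonneg S hne
      h.η_nonneg (h.scale_le (by
        unfold uniformBudget
        rw [div_le_div_iff₀ (by positivity) hα]
        have : 12 * (M : ℝ) * H.card * (α / 2 * (1 / M)) = 6 * H.card * α := by
          field_simp
          ring
        rw [this]
        have : (0 : ℝ) ≤ H.card * α := by positivity
        linarith)) (by rw [hcard]; nlinarith [h.η_nonneg]) (by rw [hcard]) zero_le_one
        (by rw [hcard, div_self hm.ne']; simpa using h.η_nonneg) 1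
    simpa [initState, hall] using this
  · intro v hv
    left
    simpa [initState, eq_comm] using hv

theorem SmallNoise.newItem_spec (h : SmallNoise H S M ε α L η ω) (hH : H.Nonempty) (T : Tree X)
    {v : ℕ} (hv : v < 2 * M + 1) (d : ℕ) :
    (∀ e ∈ newItem (noisyCounts H hH f ω) (uniformBudget M) S M ε α ω T v d,
      e.leaf = v ∧ GoodItem H f (dataSize S) (101 * √η) (nodeData S T v) e) ∧
    ((∃ e ∈ newItem (noisyCounts H hH f ω) (uniformBudget M) S M ε α ω T v d, e.leaf = v) ∨
      ((nodeData S T v).card : ℝ) ≤ dataSize S * (ε / M + η)) := by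
  have hm := h.size_pos'
  have hM := h.M_pos'
  have hα := h.α_pos
  have hc : (1 : ℝ) ≤ H.card := by exact_mod_cast hH.card_pos
  set w := noisyCount ω v (leafData S T v) .weight (2 / (α / 2 * uniformBudget M d))
    (fun _ => true) / dataSize S with hw
  have hs : 2 / (α / 2 * uniformBudget M d) = 4 * M / α := by
    unfold uniformBudget
    field_simp
    norm_num
  have hwn : |w - (nodeData S T v).card / dataSize S| ≤ η := by
    rw [hw, ← sub_div, abs_div, abs_of_pos hm, div_le_iff₀ hm, ← cnt_true, ← sum_leafData, hs]
    refine (abs_noisyCount_sub_le (fun j => h.bounded v hv j _ ?_) (by positivity) _ _).trans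
      (h.scale_le ?_)
    · simp [queries]
    · refine div_le_div_of_nonneg_right ?_ hα.le
      nlinarith
  have h40 := h.forty_mul_le
  have hη := h.η_nonneg
  have hεM : 0 < ε / M := div_pos h.ε_pos hM
  rw [abs_le] at hwn
  unfold newItem
  dsimp only
  rw [← hw]
  split_ifs with hif
  · refine ⟨?_, Or.inl ⟨_, List.mem_singleton_self _, rfl⟩⟩
    intro e he
    rw [List.mem_singleton] at he
    subst he
    refine ⟨rfl, ?_⟩
    -- Passing the threshold `ε/M ≥ 40 η` with a weight error of `η` forces enough data for the
    -- accuracy estimate, which needs `4 η`.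
    have hbig : 39 * η * dataSize S ≤ (nodeData S T v).card ∧
        (0 : ℝ) < (nodeData S T v).card := by
      have h1 : 39 * η ≤ (nodeData S T v).card / dataSize S := by linarith
      have h2 : (0 : ℝ) < (nodeData S T v).card / dataSize S := by linarith
      exact ⟨(le_div_iff₀ hm).1 h1, by
        have := mul_pos h2 hm
        rwa [div_mul_cancel₀ _ hm.ne'] at this⟩
    rw [← sum_leafData] at hbig hwn ⊢
    refine goodItem_of_noiseBounded hH h.bounded hv (by unfold uniformBudget; positivity)
      h.L_nonneg _ ?_ hη (h.scale_le (le_of_eq ?_)) ?_ ?_ (by linarith) (abs_le.2 hwn) d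
    · rw [← Multiset.card_pos]
      exact_mod_cast hbig.2
    · unfold uniformBudget
      field_simp
      ring
    · nlinarith [hbig.1]
    · rw [sum_leafData]
      exact_mod_cast card_nodeData_le S T v
  · refine ⟨by simp, Or.inr ?_⟩
    have : (nodeData S T v).card / dataSize S ≤ ε / M + η := by linarith
    rwa [div_le_iff₀ hm, mul_comm] at this

theorem SmallNoise.invariant_step (h : SmallNoise H S M ε α L η ω) (hH : H.Nonempty) {t : ℕ}
    (ht : t < M) {s : State X} {A : Finset ℕ} (hs : Invariant H f S M ε η t s A) {e : Item X}
    (he : s.queue.argmax Item.priority = some e) :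
    ∃ A', Invariant H f S M ε η (t + 1)
        (step (noisyCounts H hH f ω) (uniformBudget M) S M ε α ω t s) A' ∧
      potential f S (step (noisyCounts H hH f ω) (uniformBudget M) S M ε α ω t s).tree A' =
        potential f S s.tree A - (nodeData S s.tree e.leaf).card *
          exactDrop (cell f e.split (nodeData S s.tree e.leaf)) := by
  have hem : e ∈ s.queue := List.argmax_mem he
  have hlA := hs.leaf_mem e hem
  -- Names in use are below `2t + 1`, hence the two new ones are fresh.
  have n0 : 2 * t + 1 ∉ A := fun hc => by have := hs.lt _ hc; omega
  have n1 : 2 * t + 2 ∉ A := fun hc => by have := hs.lt _ hc; omega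
  set T := s.tree.split e.leaf e.split (2 * t + 1) (2 * t + 2) with hT
  obtain ⟨g0, q0⟩ := h.newItem_spec (f := f) hH T (v := 2 * t + 1) (by omega) (e.depth + 1)
  obtain ⟨g1, q1⟩ := h.newItem_spec (f := f) hH T (v := 2 * t + 2) (by omega) (e.depth + 1)
  have hold : ∀ u ∈ A, u ≠ e.leaf → nodeData S T u = nodeData S s.tree u := fun u hu hue =>
    nodeData_split_of_ne hue (fun hc => n0 (hc ▸ hu)) (fun hc => n1 (hc ▸ hu))
  refine ⟨insert (2 * t + 1) (insert (2 * t + 2) (A.erase e.leaf)), ?_, ?_⟩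
  · rw [step, he]
    dsimp only
    rw [← hT]
    refine ⟨?_, ?_, ?_, ?_, ?_, ?_⟩
    · intro x
      dsimp only
      rw [hT, Tree.route_split]
      by_cases hx : s.tree.route x = e.leaf
      · cases e.split x <;> simp [hx]
      · simp [hx, hs.route_mem x]
    · intro v hv
      simp only [Finset.mem_insert, Finset.mem_erase] at hv
      rcases hv with rfl | rfl | hv
      · omega
      · omega
      · have := hs.lt _ hv.2
        omega
    · refine (Finset.card_insert_le _ _).trans ?_
      have a1 := Finset.card_insert_le (2 * t + 2) (A.erase e.leaf)
      have a2 := Finset.card_erase_add_one hlA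
      have a3 := hs.card_le
      omega
    · intro e' he'
      simp only [List.mem_append, List.mem_filter, decide_eq_true_eq] at he'
      rcases he' with (⟨h1, h2⟩ | h1) | h1
      · simp [h2, hs.leaf_mem e' h1]
      · simp [(g0 e' h1).1]
      · simp [(g1 e' h1).1]
    · intro e' he'
      simp only [List.mem_append, List.mem_filter, decide_eq_true_eq] at he'
      rcases he' with (⟨h1, h2⟩ | h1) | h1
      · dsimp only
        rw [hold _ (hs.leaf_mem e' h1) h2]
        exact hs.good e' h1
      · dsimp only
        rw [(g0 e' h1).1]
        exact (g0 e' h1).2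
      · dsimp only
        rw [(g1 e' h1).1]
        exact (g1 e' h1).2
    · intro v hv
      simp only [Finset.mem_insert, Finset.mem_erase] at hv
      simp only [List.mem_append, List.mem_filter, decide_eq_true_eq]
      rcases hv with rfl | rfl | ⟨hve, hv⟩
      · exact q0.imp_left fun ⟨e', h1, h2⟩ => ⟨e', Or.inl (Or.inr h1), h2⟩
      · exact q1.imp_left fun ⟨e', h1, h2⟩ => ⟨e', Or.inr h1, h2⟩
      · rw [hold v hv hve]
        exact (hs.queued v hv).imp_left fun ⟨e', h1, h2⟩ =>
          ⟨e', Or.inl (Or.inl ⟨h1, h2 ▸ hve⟩), h2⟩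
  · rw [step, he]
    exact potential_split hs.route_mem hlA n0 n1 (by omega) (hs.good e hem).ne_zero

end

/-! ### The potential and the training error -/

/-- Concavity: the proportion at the node is the weighted mean of those at the children. Hence later
splits cannot undo progress. -/
theorem exactDrop_nonneg {c : Bool → Bool → ℝ} (hc : ∀ a b, 0 ≤ c a b) {n : ℝ}
    (hn : c false false + c false true + (c true false + c true true) = n) (hn0 : 0 < n) :
    0 ≤ exactDrop c := by
  have hl := Real.log_pos one_lt_two
  have e := mul_exactDrop hn hn0.ne'
  have hmem : ∀ b, c true b / (c false b + c true b) ∈ Set.Icc (0 : ℝ) 1 := fun b =>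
    ⟨div_nonneg (hc _ _) (add_nonneg (hc _ _) (hc _ _)),
      div_le_one_of_le₀ (by linarith [hc false b]) (add_nonneg (hc _ _) (hc _ _))⟩
  have hw : ∀ b, 0 ≤ (c false b + c true b) / n := fun b =>
    div_nonneg (add_nonneg (hc _ _) (hc _ _)) hn0.le
  have h := Real.strictConcave_binEntropy.concaveOn.2 (hmem false) (hmem true) (hw false) (hw true)
    (by rw [← add_div, div_eq_one_iff_eq hn0.ne', ← hn]; ring)
  simp only [smul_eq_mul] at h
  have hmul : ∀ b, (c false b + c true b) / n * (c true b / (c false b + c true b)) =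
      c true b / n := by
    intro b
    rcases eq_or_lt_of_le (add_nonneg (hc false b) (hc true b)) with h0 | h0
    · have : c true b = 0 := by linarith [hc false b, hc true b]
      simp [this]
    · field_simp
  rw [hmul, hmul, ← add_div] at h
  rw [entropy_of_mem (hmem false).1 (hmem false).2, entropy_of_mem (hmem true).1 (hmem true).2,
    entropy_of_mem (div_nonneg (add_nonneg (hc _ _) (hc _ _)) hn0.le) ((div_le_one hn0).2
      (by linarith [hc false false, hc false true]))] at e
  have h2 := mul_le_mul_of_nonneg_left h hn0.le
  have h3 : 0 ≤ n * exactDrop c * Real.log 2 := by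
    rw [e]
    field_simp
    field_simp at h2
    linarith
  have h4 : 0 ≤ n * exactDrop c := nonneg_of_mul_nonneg_left h3 hl
  exact nonneg_of_mul_nonneg_right h4 hn0

theorem cnt_eq_sum_filter (p : X → Bool) (r : X → ℕ) {A : Finset ℕ} (hr : ∀ x, r x ∈ A)
    (D : Multiset X) : cnt p D = ∑ v ∈ A, cnt p (D.filter fun x => r x = v) := by
  unfold cnt
  norm_cast
  induction D using Multiset.induction_on with
  | empty => simp
  | cons x D ih =>
    simp only [Multiset.countP_filter, Multiset.countP_cons] at ih ⊢
    rw [Finset.sum_add_distrib, ← ih]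
    congr 1
    cases p x <;> simp [hr x]

theorem sum_card_nodeData (S : Fin k → Multiset X) {T : Tree X} {A : Finset ℕ}
    (hA : ∀ x, T.route x ∈ A) : ∑ v ∈ A, ((nodeData S T v).card : ℝ) = dataSize S := by
  rw [← card_sum_eq_dataSize, ← cnt_true, cnt_eq_sum_filter _ T.route hA]
  simp only [cnt_true]
  rfl

theorem potential_le_dataSize (f : X → Bool) (S : Fin k → Multiset X) {T : Tree X} {A : Finset ℕ}
    (hA : ∀ x, T.route x ∈ A) : potential f S T A ≤ dataSize S := by
  rw [← sum_card_nodeData S hA]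
  exact Finset.sum_le_sum fun v _ => nodeEntropy_le_card _ _

section

variable {H : Finset (X → Bool)} {f : X → Bool} {S : Fin k → Multiset X} {M : ℕ} {ε α L η : ℝ}
  {ω : Noise k X}

/-- A minority label can win only if the two true counts differ by at most twice the count error. -/
theorem SmallNoise.cnt_leafLabel_le (h : SmallNoise H S M ε α L η ω) (hH : H.Nonempty)
    (T : Tree X) {v : ℕ} (hv : v < 2 * M + 1) :
    cnt (fun x => f x == !(leafLabel f S α ω T v)) (nodeData S T v) ≤
      min (cnt (fun x => f x == false) (nodeData S T v))
        (cnt (fun x => f x == true) (nodeData S T v)) + 2 * (η * dataSize S) := by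
  have hα := h.α_pos
  have hM1 : (1 : ℝ) ≤ M := by exact_mod_cast h.M_pos
  have hc : (1 : ℝ) ≤ H.card := by exact_mod_cast hH.card_pos
  have key : ∀ a, |noisyCount ω v (leafData S T v) (.label a) (4 / α) (fun x => f x == a) -
      cnt (fun x => f x == a) (nodeData S T v)| ≤ η * dataSize S := by
    intro a
    rw [← sum_leafData]
    refine (abs_noisyCount_sub_le (fun j => h.bounded v hv j _ ?_) (by positivity) _ _).trans
      (h.scale_le (div_le_div_of_nonneg_right ?_ hα.le))
    · simp [queries]
    · nlinarith
  have k0 := abs_le.1 (key false)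
  have k1 := abs_le.1 (key true)
  have hη : 0 ≤ η * dataSize S := mul_nonneg h.η_nonneg h.size_pos'.le
  rw [leafLabel]
  dsimp only
  split_ifs with hif
  · simp only [Bool.not_true]
    rw [← sub_le_iff_le_add]
    exact le_min (by linarith) (by linarith)
  · simp only [Bool.not_false]
    rw [← sub_le_iff_le_add]
    exact le_min (by linarith) (by linarith)

theorem trainingError_eq (f : X → Bool) (S : Fin k → Multiset X) (T : LabeledTree X) :
    trainingError f S T = cnt (fun x => T.predict x != f x) (∑ j, S j) / dataSize S := by
  rw [trainingError, cnt_sum]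
  congr 1
  refine Finset.sum_congr rfl fun j _ => ?_
  rw [cnt]
  congr 1
  refine Multiset.countP_congr rfl fun x _ => ?_
  simp

theorem SmallNoise.trainingError_le_potential (h : SmallNoise H S M ε α L η ω) (hH : H.Nonempty)
    {s : State X} {A : Finset ℕ} (hs : Invariant H f S M ε η M s A) :
    trainingError f S ⟨s.tree, leafLabel f S α ω s.tree⟩ * dataSize S ≤
      potential f S s.tree A / 2 + 4 * M * η * dataSize S := by
  have hm := h.size_pos'
  rw [trainingError_eq, div_mul_cancel₀ _ hm.ne', cnt_eq_sum_filter _ s.tree.route hs.route_mem]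
  have h1 : ∀ v ∈ A, cnt (fun x => LabeledTree.predict ⟨s.tree, leafLabel f S α ω s.tree⟩ x != f x)
      ((∑ j, S j).filter fun x => s.tree.route x = v) ≤
      nodeEntropy f (nodeData S s.tree v) / 2 + 2 * (η * dataSize S) := by
    intro v hv
    have e : cnt (fun x => LabeledTree.predict ⟨s.tree, leafLabel f S α ω s.tree⟩ x != f x)
        (nodeData S s.tree v) =
        cnt (fun x => f x == !(leafLabel f S α ω s.tree v)) (nodeData S s.tree v) := by
      unfold cnt
      congr 1
      refine Multiset.countP_congr rfl fun x hx => ?_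
      have hx' : s.tree.route x = v := (Multiset.mem_filter.1 hx).2
      simp only [LabeledTree.predict, hx']
      cases leafLabel f S α ω s.tree v <;> cases f x <;> simp
    refine (le_of_eq e).trans ((h.cnt_leafLabel_le hH s.tree (hs.lt v hv)).trans ?_)
    linarith [two_mul_min_cnt_le_nodeEntropy f (nodeData S s.tree v)]
  refine (Finset.sum_le_sum h1).trans ?_
  rw [Finset.sum_add_distrib, Finset.sum_const, nsmul_eq_mul, ← Finset.sum_div]
  refine add_le_add le_rfl ?_
  have hc : (A.card : ℝ) ≤ 2 * M := by
    have h2 := hs.card_le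
    have h3 := h.M_pos
    have : A.card ≤ 2 * M := by omega
    exact_mod_cast this
  have := mul_le_mul_of_nonneg_right hc
    (show 0 ≤ 2 * (η * dataSize S) from mul_nonneg zero_le_two (mul_nonneg h.η_nonneg hm.le))
  linarith

/-- While the potential is large, some queued leaf has a good share of it. -/
theorem SmallNoise.exists_queued (h : SmallNoise H S M ε α L η ω) {t : ℕ} (ht : t < M)
    {s : State X} {A : Finset ℕ} (hs : Invariant H f S M ε η t s A)
    (hbig : 9 / 5 * ε * dataSize S < potential f S s.tree A) :
    ∃ e ∈ s.queue, ε / 10 * (nodeData S s.tree e.leaf).card ≤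
        nodeEntropy f (nodeData S s.tree e.leaf) ∧
      potential f S s.tree A / (4 * (t + 1)) ≤ nodeEntropy f (nodeData S s.tree e.leaf) := by
  by_contra! hcon
  have hm := h.size_pos'
  have hM := h.M_pos'
  have hε := h.ε_pos
  set Ψ := potential f S s.tree A with hΨ
  have hΨ0 : 0 ≤ Ψ := Finset.sum_nonneg fun v _ => nodeEntropy_nonneg _ _
  have hη := h.η_nonneg
  have hu0 : 0 ≤ dataSize S * (ε / M + η) := by positivity
  have ht1 : (0 : ℝ) < 4 * (t + 1) := by positivity
  -- By contradiction, every leaf is of one of three kinds: unqueued with little data, of tiny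
  -- entropy, or with a small share. Summed, these give at most `(1 + 1/40) ε|S|`, `ε|S|/10` and
  -- `Ψ/4`, so `Ψ ≤ 3/2 ε|S|`.
  have hall : ∀ v ∈ A, nodeEntropy f (nodeData S s.tree v) ≤
      dataSize S * (ε / M + η) + ε / 10 * (nodeData S s.tree v).card + Ψ / (4 * (t + 1)) := by
    intro v hv
    have p1 : 0 ≤ ε / 10 * (nodeData S s.tree v).card := by positivity
    have p2 : 0 ≤ Ψ / (4 * (t + 1)) := by positivity
    rcases hs.queued v hv with ⟨e, he, rfl⟩ | hq
    · by_cases hc : ε / 10 * (nodeData S s.tree e.leaf).card ≤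
        nodeEntropy f (nodeData S s.tree e.leaf)
      · linarith [hcon e he hc]
      · linarith
    · linarith [nodeEntropy_le_card f (nodeData S s.tree v)]
  have hsum := Finset.sum_le_sum hall
  rw [Finset.sum_add_distrib, Finset.sum_add_distrib, ← Finset.mul_sum (a := ε / 10),
    sum_card_nodeData S hs.route_mem, Finset.sum_const, Finset.sum_const, nsmul_eq_mul,
    nsmul_eq_mul] at hsum
  change Ψ ≤ _ at hsum
  have hA1 : (A.card : ℝ) ≤ t + 1 := by exact_mod_cast hs.card_le
  have hA2 : (A.card : ℝ) ≤ M := by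
    have := hs.card_le
    exact_mod_cast (by omega : A.card ≤ M)
  have s1 := mul_le_mul_of_nonneg_right hA2 hu0
  have s2 := mul_le_mul_of_nonneg_right hA1 (show 0 ≤ Ψ / (4 * (t + 1)) by positivity)
  have e1 : (M : ℝ) * (dataSize S * (ε / M + η)) = dataSize S * (ε + M * η) := by
    field_simp
  have e2 : ((t : ℝ) + 1) * (Ψ / (4 * (t + 1))) = Ψ / 4 := by
    field_simp
  rw [e1] at s1
  rw [e2] at s2
  have s3 : dataSize S * (ε + M * η) ≤ dataSize S * (ε + ε / 40) :=
    mul_le_mul_of_nonneg_left (by linarith [h.η_le]) hm.le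
  have : 0 < ε * dataSize S := by positivity
  linarith

/-- The popped leaf need not be the one with a large share, but its priority is at least as high, so
its true drop is as good up to two priority errors. -/
theorem SmallNoise.potential_step_le (h : SmallNoise H S M ε α L η ω) (hH : H.Nonempty) {γ l : ℝ}
    (hγ : 0 ≤ γ) (hw : WeakLearning H f γ) (hl : 1 / 2 ≤ l) (hlε : Real.exp (-l) = ε)
    (hξ : 9696 * l * M * √η ≤ γ ^ 2 * ε) {t : ℕ} (ht : t < M) {s : State X} {A : Finset ℕ}
    (hs : Invariant H f S M ε η t s A)
    (hbig : 9 / 5 * ε * dataSize S < potential f S s.tree A) :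
    ∃ A', Invariant H f S M ε η (t + 1)
        (step (noisyCounts H hH f ω) (uniformBudget M) S M ε α ω t s) A' ∧
      potential f S (step (noisyCounts H hH f ω) (uniformBudget M) S M ε α ω t s).tree A' ≤
        potential f S s.tree A * Real.exp (-(γ ^ 2 / (48 * l)) * (t + 1 : ℝ)⁻¹) := by
  obtain ⟨e', he', h1, h2⟩ := h.exists_queued ht hs hbig
  obtain ⟨e, he⟩ : ∃ e, s.queue.argmax Item.priority = some e := by
    rw [← Option.ne_none_iff_exists']
    intro hc
    rw [List.argmax_eq_none] at hc
    simp [hc] at he'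
  obtain ⟨A', hA', hp⟩ := h.invariant_step (f := f) hH ht hs he
  refine ⟨A', hA', ?_⟩
  rw [hp]
  have hm := h.size_pos'
  have hM := h.M_pos'
  have hl0 : 0 < l := by linarith
  have hge := hs.good e (List.argmax_mem he)
  have hge' := hs.good e' he'
  obtain ⟨g, hg, hgd⟩ := hw.exists_nodeEntropy_le hγ hge'.ne_zero hl (by rw [hlε]; exact h1)
  have i1 := hge'.drop_le g hg
  have i2 := hge.le_drop
  have i3 : e'.priority ≤ e.priority := List.le_of_mem_argmax he' he
  set Ψ := potential f S s.tree A with hΨ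
  set Δ := (nodeData S s.tree e.leaf).card *
    exactDrop (cell f e.split (nodeData S s.tree e.leaf)) with hΔ
  have hΨ0 : 0 ≤ Ψ := Finset.sum_nonneg fun v _ => nodeEntropy_nonneg _ _
  have j1 : γ ^ 2 / (6 * l) * (Ψ / (4 * (t + 1))) ≤ Δ + 2 * (dataSize S * (101 * √η)) := by
    have a1 := mul_le_mul_of_nonneg_left h2 (show 0 ≤ γ ^ 2 / (6 * l) by positivity)
    have a2 := mul_le_mul_of_nonneg_left i3 hm.le
    linarith
  have ht1 : (0 : ℝ) < t + 1 := by positivity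
  have htM : (t + 1 : ℝ) ≤ M := by exact_mod_cast ht
  -- The noise takes at most half of the gain; `9696 = 96 * 101`. The lower bound on `Ψ` makes an
  -- absolute error relative.
  have j2 : 2 * (dataSize S * (101 * √η)) ≤ γ ^ 2 / (48 * l) * (t + 1 : ℝ)⁻¹ * Ψ := by
    have b1 : 101 * √η ≤ γ ^ 2 * ε / (96 * l * M) := by
      rw [le_div_iff₀ (by positivity)]
      linarith
    have b2 : γ ^ 2 * ε / (96 * l * M) ≤ γ ^ 2 * ε / (96 * l * (t + 1)) := by
      have := h.ε_pos
      gcongr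
    have b3 := mul_le_mul_of_nonneg_left (b1.trans b2) hm.le
    have b4 : γ ^ 2 / (48 * l) * (t + 1 : ℝ)⁻¹ * (9 / 5 * ε * dataSize S) ≤
        γ ^ 2 / (48 * l) * (t + 1 : ℝ)⁻¹ * Ψ :=
      mul_le_mul_of_nonneg_left hbig.le (by positivity)
    have b5 : dataSize S * (γ ^ 2 * ε / (96 * l * (t + 1))) =
        γ ^ 2 / (48 * l) * (t + 1 : ℝ)⁻¹ * (ε * dataSize S) / 2 := by
      field_simp
      ring
    have b6 : 0 ≤ γ ^ 2 / (48 * l) * (t + 1 : ℝ)⁻¹ * (ε * dataSize S) := by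
      have := h.ε_pos
      positivity
    linarith
  have j3 : γ ^ 2 / (6 * l) * (Ψ / (4 * (t + 1))) =
      2 * (γ ^ 2 / (48 * l) * (t + 1 : ℝ)⁻¹ * Ψ) := by
    field_simp
    ring
  have j4 := Real.add_one_le_exp (-(γ ^ 2 / (48 * l)) * (t + 1 : ℝ)⁻¹)
  have j5 := mul_le_mul_of_nonneg_left j4 hΨ0
  linarith

theorem SmallNoise.invariant_step' (h : SmallNoise H S M ε α L η ω) (hH : H.Nonempty) {t : ℕ}
    (ht : t < M) {s : State X} {A : Finset ℕ} (hs : Invariant H f S M ε η t s A) :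
    ∃ A', Invariant H f S M ε η (t + 1)
        (step (noisyCounts H hH f ω) (uniformBudget M) S M ε α ω t s) A' ∧
      potential f S (step (noisyCounts H hH f ω) (uniformBudget M) S M ε α ω t s).tree A' ≤
        potential f S s.tree A := by
  rcases he : s.queue.argmax Item.priority with _ | e
  · refine ⟨A, ?_, ?_⟩
    · rw [step, he]
      exact ⟨hs.route_mem, fun v hv => (hs.lt v hv).trans (by omega), hs.card_le.trans (by omega),
        hs.leaf_mem, hs.good, hs.queued⟩
    · rw [step, he]
  · obtain ⟨A', hA', hp⟩ := h.invariant_step (f := f) hH ht hs he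
    refine ⟨A', hA', ?_⟩
    rw [hp]
    have hD := (hs.good e (List.argmax_mem he)).ne_zero
    have hn : (0 : ℝ) < (nodeData S s.tree e.leaf).card := by
      exact_mod_cast Multiset.card_pos.2 hD
    have := mul_nonneg hn.le
      (exactDrop_nonneg (cell_nonneg f e.split _) (card_eq_cell f e.split _) hn)
    linarith

theorem SmallNoise.exists_invariant (h : SmallNoise H S M ε α L η ω) (hH : H.Nonempty) {t : ℕ}
    (ht : t ≤ M) :
    ∃ A, Invariant H f S M ε η t
      (run (noisyCounts H hH f ω) (uniformBudget M) S M ε α ω t) A := by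
  induction t with
  | zero => exact ⟨_, h.invariant_init hH⟩
  | succ t ih =>
    obtain ⟨A, hA⟩ := ih (by omega)
    obtain ⟨A', hA', -⟩ := h.invariant_step' hH (by omega) hA
    exact ⟨A', hA'⟩

/-- The factors `exp(-c/(t+1))` multiply to a harmonic exponent as long as the potential is large;
once below the threshold it stays there by monotonicity. -/
theorem SmallNoise.exists_potential_le (h : SmallNoise H S M ε α L η ω) (hH : H.Nonempty) {γ l : ℝ}
    (hγ : 0 ≤ γ) (hw : WeakLearning H f γ) (hl : 1 / 2 ≤ l) (hlε : Real.exp (-l) = ε)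
    (hξ : 9696 * l * M * √η ≤ γ ^ 2 * ε) {t : ℕ} (ht : t ≤ M) :
    ∃ A, Invariant H f S M ε η t
        (run (noisyCounts H hH f ω) (uniformBudget M) S M ε α ω t) A ∧
      (potential f S (run (noisyCounts H hH f ω) (uniformBudget M) S M ε α ω t).tree A ≤
          9 / 5 * ε * dataSize S ∨
        potential f S (run (noisyCounts H hH f ω) (uniformBudget M) S M ε α ω t).tree A ≤
          dataSize S * Real.exp (-(γ ^ 2 / (48 * l)) * (harmonic t : ℝ))) := by
  induction t with
  | zero =>
    have h0 := h.invariant_init (f := f) hH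
    refine ⟨_, h0, Or.inr ?_⟩
    simpa [run] using potential_le_dataSize f S h0.route_mem
  | succ t ih =>
    obtain ⟨A, hA, hp⟩ := ih (by omega)
    rcases le_or_gt (potential f S (run (noisyCounts H hH f ω) (uniformBudget M) S M ε α ω t).tree A)
      (9 / 5 * ε * dataSize S) with hsm | hbig
    · obtain ⟨A', hA', hp'⟩ := h.invariant_step' hH (by omega) hA
      exact ⟨A', hA', Or.inl (hp'.trans hsm)⟩
    · obtain ⟨A', hA', hp'⟩ := h.potential_step_le hH hγ hw hl hlε hξ (by omega) hA hbig
      refine ⟨A', hA', Or.inr (hp'.trans ?_)⟩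
      have := hp.resolve_left (not_le.2 hbig)
      refine (mul_le_mul_of_nonneg_right this (Real.exp_pos _).le).trans (le_of_eq ?_)
      rw [mul_assoc, ← Real.exp_add, harmonic_succ]
      push_cast
      ring_nf

/-- With small noise, the tree has a small training error. -/
theorem SmallNoise.trainingError_le (h : SmallNoise H S M ε α L η ω) (hH : H.Nonempty) {γ : ℝ}
    (hγ : 0 < γ) (hw : WeakLearning H f γ)
    (hξ : 9696 * Real.log (1 / ε) * M * √η ≤ γ ^ 2 * ε)
    (hM : 48 * Real.log (1 / ε) ^ 2 / γ ^ 2 ≤ Real.log M) :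
    trainingError f S
      (dpTopDown (noisyCounts H hH f ω) (uniformBudget M) f S M ε α ω) ≤ ε := by
  have hm := h.size_pos'
  have hε := h.ε_pos
  have hMp := h.M_pos'
  set l := Real.log (1 / ε) with hl
  have hlε : Real.exp (-l) = ε := by
    rw [hl, one_div, Real.log_inv, neg_neg, Real.exp_log hε]
  obtain ⟨A, hA, hp⟩ : ∃ A, Invariant H f S M ε η M
      (run (noisyCounts H hH f ω) (uniformBudget M) S M ε α ω M) A ∧
      potential f S (run (noisyCounts H hH f ω) (uniformBudget M) S M ε α ω M).tree A ≤
        9 / 5 * ε * dataSize S := by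
    rcases le_or_gt (1 / 2) l with hl2 | hl2
    · obtain ⟨A, hA, hp⟩ := h.exists_potential_le hH hγ.le hw hl2 hlε hξ le_rfl
      refine ⟨A, hA, hp.elim id fun hp => hp.trans ?_⟩
      have hl0 : 0 < l := by linarith
      have h1 : Real.log M ≤ harmonic M :=
        (Real.log_le_log hMp (by push_cast; linarith)).trans (log_add_one_le_harmonic M)
      have h2 : l ≤ γ ^ 2 / (48 * l) * (harmonic M : ℝ) := by
        have := mul_le_mul_of_nonneg_left (hM.trans h1) (show 0 ≤ γ ^ 2 / (48 * l) by positivity)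
        refine le_trans (le_of_eq ?_) this
        field_simp
      have h3 : Real.exp (-(γ ^ 2 / (48 * l)) * (harmonic M : ℝ)) ≤ ε := by
        rw [← hlε]
        exact Real.exp_le_exp.2 (by linarith)
      have := mul_le_mul_of_nonneg_left h3 hm.le
      have : 0 < ε * dataSize S := by positivity
      linarith
    -- For `l < 1/2` the comparison of `G(q)` with `l q(1-q)` is not available, but then `9/5 ε ≥ 1`
    -- and the trivial bound on the potential suffices.
    · obtain ⟨A, hA⟩ := h.exists_invariant (f := f) hH le_rfl
      refine ⟨A, hA, (potential_le_dataSize f S hA.route_mem).trans ?_⟩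
      have h1 : 5 / 9 ≤ ε := by
        rw [← hlε]
        have h2 : Real.exp (-(1 / 2)) ≤ Real.exp (-l) := Real.exp_le_exp.2 (by linarith)
        have h3 := Real.exp_one_lt_d9
        have h4 : Real.exp (-(1 / 2)) ^ 2 * Real.exp 1 = 1 := by
          rw [← Real.exp_nat_mul, ← Real.exp_add]
          norm_num
        have h5 := Real.exp_pos (-(1 / 2))
        by_contra hc
        have h6 : Real.exp (-(1 / 2)) < 5 / 9 := by linarith
        nlinarith
      nlinarith
  have he := h.trainingError_le_potential hH hA
  have h40 := mul_le_mul_of_nonneg_right h.η_le hm.le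
  refine le_of_mul_le_mul_right ?_ hm
  rw [dpTopDown]
  refine he.trans ?_
  -- Half of the potential gives `9/10 ε`, and the noisy labels `4Mη ≤ ε/10`.
  linarith

end

/-! ### The noise is small with high probability -/

theorem stdLaplace_tail {L : ℝ} (hL : 0 ≤ L) :
    stdLaplace {x | L < |x|} = ENNReal.ofReal (Real.exp (-L)) := by
  have hmeas : MeasurableSet {x : ℝ | L < |x|} :=
    measurableSet_lt measurable_const measurable_id.abs
  have h := integral_comp_abs (f := (Set.Ioi L).indicator fun x => Real.exp (-x) / 2)
  have hsub : Set.Ioi (0 : ℝ) ∩ Set.Ioi L = Set.Ioi L :=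
    Set.inter_eq_right.2 (Set.Ioi_subset_Ioi hL)
  have e : (fun x : ℝ => (Set.Ioi L).indicator (fun x => Real.exp (-x) / 2) |x|) =
      {x : ℝ | L < |x|}.indicator fun x => Real.exp (-|x|) / 2 := by
    funext x
    simp [Set.indicator_apply]
  rw [setIntegral_indicator measurableSet_Ioi, hsub, integral_div, integral_exp_neg_Ioi, e,
    integral_indicator hmeas] at h
  have hne : (∫ x in {x : ℝ | L < |x|}, Real.exp (-|x|) / 2) = Real.exp (-L) := by
    rw [h]; ring
  have hi : Integrable (fun x : ℝ => Real.exp (-|x|) / 2)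
      (volume.restrict {x : ℝ | L < |x|}) := by
    by_contra hc
    rw [integral_undef hc] at hne
    exact (Real.exp_pos (-L)).ne hne
  rw [stdLaplace, withDensity_apply _ hmeas,
    ← ofReal_integral_eq_lintegral_ofReal hi (Filter.Eventually.of_forall fun x => by positivity),
    hne]

theorem noiseLaw_tail {k : ℕ} {X : Type*} (i : ℕ × Fin k × Query X) {L : ℝ} (hL : 0 ≤ L) :
    (noiseLaw k X).real {ω | L < |ω i|} = Real.exp (-L) := by
  have hmeas : MeasurableSet {x : ℝ | L < |x|} :=
    measurableSet_lt measurable_const measurable_id.abs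
  have h := Measure.infinitePi_map_eval (fun _ : ℕ × Fin k × Query X => stdLaplace) i
  have h2 : noiseLaw k X {ω | L < |ω i|} = stdLaplace {x | L < |x|} := by
    rw [← h, Measure.map_apply (measurable_pi_apply i) hmeas]
    rfl
  rw [measureReal_def, h2, stdLaplace_tail hL, ENNReal.toReal_ofReal (Real.exp_pos _).le]

instance noiseLaw_isProbabilityMeasure (k : ℕ) (X : Type*) :
    IsProbabilityMeasure (noiseLaw k X) := by
  unfold noiseLaw
  infer_instance

/-- A union bound over nodes, holders and queries, of which there are finitely many even if `X` is
infinite. -/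
theorem one_sub_le_noiseLaw_noiseBounded {k : ℕ} {X : Type*} (H : Finset (X → Bool)) (M : ℕ)
    {L : ℝ} (hL : 0 ≤ L) :
    1 - (2 * M + 1) * k * (3 + 8 * H.card) * Real.exp (-L) ≤
      (noiseLaw k X).real {ω | NoiseBounded H M L ω} := by
  set I := Finset.range (2 * M + 1) ×ˢ ((Finset.univ : Finset (Fin k)) ×ˢ queries H) with hI
  have hset : {ω : Noise k X | NoiseBounded H M L ω}ᶜ = ⋃ i ∈ I, {ω | L < |ω i|} := by
    ext ω
    simp only [hI, NoiseBounded, Set.mem_compl_iff, Set.mem_ofPred_eq, Set.mem_iUnion,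
      Finset.mem_product, Finset.mem_range, Finset.mem_univ, true_and, exists_prop, Prod.exists]
    push Not
    constructor
    · rintro ⟨v, hv, j, c, hc, h⟩
      exact ⟨v, j, c, ⟨hv, hc⟩, h⟩
    · rintro ⟨v, j, c, ⟨hv, hc⟩, h⟩
      exact ⟨v, hv, j, c, hc, h⟩
  have hmeas : MeasurableSet {ω : Noise k X | NoiseBounded H M L ω} := by
    rw [← MeasurableSet.compl_iff, hset]
    exact Finset.measurableSet_biUnion _ fun i _ =>
      measurableSet_lt measurable_const (measurable_pi_apply i).abs
  have h1 : (noiseLaw k X).real {ω : Noise k X | NoiseBounded H M L ω}ᶜ ≤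
      I.card * Real.exp (-L) := by
    rw [hset]
    refine (measureReal_biUnion_finset_le _ _).trans (le_of_eq ?_)
    rw [Finset.sum_congr rfl fun i _ => noiseLaw_tail i hL, Finset.sum_const, nsmul_eq_mul]
  have h2 : (I.card : ℝ) ≤ (2 * M + 1) * k * (3 + 8 * H.card) := by
    have : I.card ≤ (2 * M + 1) * k * (3 + 8 * H.card) := by
      rw [hI, Finset.card_product, Finset.card_product, Finset.card_range, Finset.card_univ,
        Fintype.card_fin, mul_assoc]
      exact Nat.mul_le_mul le_rfl (Nat.mul_le_mul le_rfl (card_queries_le H))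
    exact_mod_cast this
  have h3 := mul_le_mul_of_nonneg_right h2 (Real.exp_pos (-L)).le
  have h4 := probReal_add_probReal_compl (μ := noiseLaw k X) hmeas
  linarith

end DPTree

theorem mainTheorem6 :
    ∃ C₁ C₂ : ℝ, ∃ p : ℕ, 0 < C₁ ∧ 0 < C₂ ∧
      ∀ {X : Type*} (H : Finset (X → Bool)) (hH : H.Nonempty) (f : X → Bool) (γ : ℝ),
        0 < γ → DPTree.WeakLearning H f γ →
      ∀ (k : ℕ), 0 < k → ∀ (S : Fin k → Multiset X) (α ε δ : ℝ),
        0 < α → 0 < ε → ε ≤ 1 → 0 < δ → δ ≤ 1 →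
      ∀ (M : ℕ), (1 / ε) ^ (C₁ * Real.log (1 / ε) / γ ^ 2) ≤ (M : ℝ) →
        C₂ * ((M : ℝ) ^ 3 * k * H.card / (ε ^ 2 * γ ^ 2 * α)) *
            Real.log (2 + M * k * H.card / (ε * γ * δ)) ^ p ≤ (DPTree.dataSize S : ℝ) →
        1 - δ ≤ (DPTree.noiseLaw k X).real
          {ω | DPTree.trainingError f S
            (DPTree.dpTopDown (DPTree.noisyCounts H hH f ω) (DPTree.uniformBudget M) f S M ε α ω)
              ≤ ε} := by
  -- `48` is the constant in the decay rate. Of the two logarithms, one pays for `L` and one for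
  -- `l²/γ²`; `10 ^ 9` leaves slack.
  refine ⟨48, 10 ^ 9, 2, by norm_num, by norm_num, ?_⟩
  intro X H hH f γ hγ hw k hk S α ε δ hα hε hε1 hδ hδ1 M hM hS
  have hM0 : (0 : ℝ) < M := lt_of_lt_of_le (Real.rpow_pos_of_pos (by positivity) _) hM
  have hMn : 0 < M := Nat.cast_pos.1 hM0
  have hM1 : (1 : ℝ) ≤ M := by exact_mod_cast hMn
  have hk1 : (1 : ℝ) ≤ k := by exact_mod_cast hk
  have hH1 : (1 : ℝ) ≤ H.card := by exact_mod_cast hH.card_pos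
  set Y : ℝ := M * k * H.card / (ε * γ * δ) with hY
  have hY0 : 0 < Y := by positivity
  set Λ := Real.log (2 + Y) with hΛ
  have hΛ2 : 1 / 2 ≤ Λ := by
    have := Real.log_le_log two_pos (show (2 : ℝ) ≤ 2 + Y by linarith)
    linarith [Real.log_two_gt_d9]
  have hΛ0 : 0 < Λ := by linarith
  have hm : (0 : ℝ) < DPTree.dataSize S := lt_of_lt_of_le (by positivity) hS
  have hγ2 : γ ≤ 1 / 2 := by
    have h1 : 0 < (∑ j, S j).card := by
      rw [DPTree.card_sum_eq_dataSize]
      exact_mod_cast hm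
    obtain ⟨x, -⟩ := Multiset.card_pos_iff_exists_mem.1 h1
    exact hw.le_half x
  set l := Real.log (1 / ε) with hl
  have hl0 : 0 ≤ l := Real.log_nonneg (by rw [le_div_iff₀ hε]; linarith)
  have hMlog : 48 * l ^ 2 / γ ^ 2 ≤ Real.log M := by
    have h1 := Real.log_le_log (Real.rpow_pos_of_pos (by positivity) _) hM
    rw [Real.log_rpow (by positivity), ← hl] at h1
    refine le_trans (le_of_eq ?_) h1
    ring
  have hcount : (1 : ℝ) ≤ M * k * H.card := by
    have h1 : (1 : ℝ) ≤ M * k := one_le_mul_of_one_le_of_one_le hM1 hk1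
    exact one_le_mul_of_one_le_of_one_le h1 hH1
  have hYδ : M * k * H.card / δ ≤ Y := by
    rw [hY]
    refine div_le_div_of_nonneg_left (by linarith) (by positivity) ?_
    have : ε * γ ≤ 1 := mul_le_one₀ hε1 hγ.le (by linarith)
    exact mul_le_of_le_one_left hδ.le this
  have hMY : (M : ℝ) ≤ Y := by
    refine le_trans ?_ hYδ
    rw [le_div_iff₀ hδ]
    have h1 : (1 : ℝ) ≤ k * H.card := one_le_mul_of_one_le_of_one_le hk1 hH1
    nlinarith
  have hMΛ : 48 * l ^ 2 / γ ^ 2 ≤ Λ :=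
    hMlog.trans (Real.log_le_log hM0 (by linarith))
  -- `33 = 3 * 11`, from `2M + 1 ≤ 3M` and `3 + 8|H| ≤ 11|H|` in the union bound.
  set L := Real.log (33 * (M * k * H.card) / δ) with hL
  have hL0 : 0 ≤ L := Real.log_nonneg (by rw [le_div_iff₀ hδ]; linarith)
  have hLΛ : L ≤ 7 * Λ := by
    have h1 : 33 * (M * k * H.card) / δ ≤ (2 + Y) ^ 7 := by
      rw [mul_div_assoc]
      have h2 : (2 : ℝ) ^ 6 ≤ (2 + Y) ^ 6 := pow_le_pow_left₀ (by norm_num) (by linarith) 6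
      have h3 : (2 + Y) ^ 7 = (2 + Y) ^ 6 * (2 + Y) := pow_succ _ _
      rw [h3]
      nlinarith
    have h4 := Real.log_le_log (by positivity) h1
    rw [Real.log_pow] at h4
    refine h4.trans (le_of_eq ?_)
    rw [hΛ]
    norm_num
  set η : ℝ := 12 * M * H.card / α * (k * L) / DPTree.dataSize S with hη
  have hη0 : 0 ≤ η := by positivity
  -- `84 = 12 * 7` from `L ≤ 7Λ`; the second `Λ` is kept on the left for `hξ`.
  have hηle : η * (10 ^ 9 * M ^ 2 * Λ) ≤ 84 * (ε ^ 2 * γ ^ 2) := by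
    have h1 : η * DPTree.dataSize S = 12 * M * H.card / α * (k * L) := by
      rw [hη]; field_simp
    have h2 := mul_le_mul_of_nonneg_left hS hη0
    rw [h1] at h2
    have h3 : 12 * M * H.card / α * (k * L) ≤ 12 * M * H.card / α * (k * (7 * Λ)) := by gcongr
    have h4 := h2.trans h3
    have h5 : 12 * M * H.card / α * (k * (7 * Λ)) =
        (M * k * H.card * Λ / (ε ^ 2 * γ ^ 2 * α)) * (84 * (ε ^ 2 * γ ^ 2)) := by
      field_simp
      norm_num
    have h6 : η * (10 ^ 9 * ((M : ℝ) ^ 3 * k * H.card / (ε ^ 2 * γ ^ 2 * α)) * Λ ^ 2) =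
        (M * k * H.card * Λ / (ε ^ 2 * γ ^ 2 * α)) * (η * (10 ^ 9 * M ^ 2 * Λ)) := by
      field_simp
    rw [h5, h6] at h4
    exact le_of_mul_le_mul_left h4 (by positivity)
  have hη40 : 40 * M * η ≤ ε := by
    have h1 : η * (10 ^ 9 * M * (1 / 2)) ≤ η * (10 ^ 9 * M ^ 2 * Λ) := by
      have : (M : ℝ) ≤ M ^ 2 := by nlinarith
      gcongr
    have h2 : ε ^ 2 * γ ^ 2 ≤ ε := by
      have h3 : ε * γ ^ 2 ≤ 1 :=
        mul_le_one₀ hε1 (sq_nonneg γ) (pow_le_one₀ hγ.le (by linarith))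
      have := mul_le_mul_of_nonneg_left h3 hε.le
      linarith
    have h4 : 0 ≤ η * M := by positivity
    linarith
  have hξ : 9696 * l * M * √η ≤ γ ^ 2 * ε := by
    refine le_of_sq_le_sq ?_ (by positivity)
    rw [mul_pow, Real.sq_sqrt hη0]
    -- The size of `M` is used here a second time: the spare `Λ` absorbs `l²` and supplies the
    -- missing `γ²`.
    have h1 : 48 * l ^ 2 ≤ Λ * γ ^ 2 := by
      rwa [div_le_iff₀ (by positivity)] at hMΛ
    have h2 := mul_le_mul_of_nonneg_left h1 (show 0 ≤ M ^ 2 * η * 10 ^ 9 by positivity)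
    have h3 := mul_le_mul_of_nonneg_right hηle (sq_nonneg γ)
    have h4 : 0 ≤ (γ ^ 2 * ε) ^ 2 := sq_nonneg _
    have h5 : 0 ≤ M ^ 2 * η * l ^ 2 := by positivity
    linarith
  have hexp : Real.exp (-L) = δ / (33 * (M * k * H.card)) := by
    rw [hL, ← Real.log_inv, Real.exp_log (by positivity), inv_div]
  have hprob := DPTree.one_sub_le_noiseLaw_noiseBounded (k := k) H M hL0
  have hδle : (2 * M + 1) * k * (3 + 8 * H.card) * Real.exp (-L) ≤ δ := by
    rw [hexp, ← mul_div_assoc, div_le_iff₀ (by positivity)]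
    have h1 : (2 * (M : ℝ) + 1) * k * (3 + 8 * H.card) ≤ (3 * M) * k * (11 * H.card) := by
      gcongr <;> linarith
    have := mul_le_mul_of_nonneg_right h1 hδ.le
    linarith
  -- Monotonicity does not require the low-error event, which depends on chosen maximizers, to be
  -- measurable.
  refine le_trans (by linarith) (hprob.trans (measureReal_mono ?_))
  intro ω hω
  have hsmall : DPTree.SmallNoise H S M ε α L η ω :=
    { M_pos := hMn
      α_pos := hα
      L_nonneg := hL0
      bounded := hω
      size_pos := Nat.cast_pos.1 hm
      noise_le := by rw [hη, div_mul_cancel₀ _ hm.ne']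
      η_nonneg := hη0
      η_le := hη40
      ε_le := hε1
      ε_pos := hε }
  exact hsmall.trainingError_le hH hγ hw hξ hMlog
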